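/- **Definitions.** Write $\|\cdot\|$ for the operator norm, $\log$ for the natural logarithm and $|0^a\rangle$ for the all-zero state of $a$ qubits. For $\alpha>0$, $a\in\mathbb N$, $\epsilon\ge 0$, an $(\alpha,a,\epsilon)$-block-encoding of a $2^n\times 2^n$ matrix $X$ is a $2^{a+n}\times 2^{a+n}$ unitary $U_X$ such that $(\langle 0^a|\otimes I)\,U_X\,(|0^a\rangle\otimes I)=X'/\alpha$ for some matrix $X'$ with $\|X-X'\|\le\epsilon$. A query circuit is a finite sequence of gates, each of which is either a unitary that does not depend on the oracle $U_H$, or a call to the oracle, that is, one application of $U_H$, of $U_H^\dagger$, or of one of these two controlled by an additional qubit; its cost is the number of calls. **Theorem (Hamiltonian simulation cost).** Let $c=\dfrac{4}{\sqrt{2\pi}\,e^{1/13}}\approx 1.47762$. Let $n,m_H\in\mathbb N$, $\alpha_H>0$, $\tau\in\mathbb R$ and $\delta>0$. There is a query circuit on $n+m_H+2$ qubits, depending only on $n,m_H,\alpha_H,\tau,\delta$, that makes exactly $$3\left\lceil \frac e2\,\alpha_H|\tau|+\log\frac{2c}{\delta}\right\rceil$$ calls (where the ceiling is read as $0$ if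 it is negative, which can happen only for $\delta>2c$), and that has the following property: for every Hermitian $2^n\times 2^n$ matrix $H$ with $\|H\|\le 1$ and every $(\alpha_H,m_H,0)$-block-encoding $U_H$ of $H$, the circuit with oracle $U_H$ implements a $(1,m_H+2,\delta)$-block-encoding of $e^{-iH\tau}$. -/

import Mathlib

open scoped Matrix.Norms.L2Operator

/-- The computational basis of a register of `k` qubits (so `2 ^ k` basis states).
The basis state with all qubits equal to zero is `0 : Qubits k`. -/
abbrev Qubits (k : ℕ) : Type := Fin k → Fin 2

/-- `IsBlockEncoding α a ε X U`: the matrix `U`, acting on `a` auxiliary qubits and `n` system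
qubits, is an `(α, a, ε)`-block-encoding of the `2 ^ n × 2 ^ n` matrix `X`: it is unitary, and its
block with all auxiliary qubits in state zero is `X' / α` with `‖X - X'‖ ≤ ε`
(`‖·‖` is the operator norm induced by the Euclidean norm). -/
def IsBlockEncoding {n : ℕ} (α : ℝ) (a : ℕ) (ε : ℝ) (X : Matrix (Qubits n) (Qubits n) ℂ)
    (U : Matrix (Qubits a × Qubits n) (Qubits a × Qubits n) ℂ) : Prop :=
  0 < α ∧ U ∈ Matrix.unitaryGroup (Qubits a × Qubits n) ℂ ∧
    ∃ X' : Matrix (Qubits n) (Qubits n) ℂ,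
      (∀ i j, U (0, i) (0, j) = X' i j / (α : ℂ)) ∧ ‖X - X'‖ ≤ ε

/-- A register of `m + k` auxiliary and `n` system qubits, regrouped as the `m + n` qubits on which
an oracle acts, together with the `k` extra auxiliary qubits. -/
def regroup (m k n : ℕ) : Qubits (m + k) × Qubits n ≃ (Qubits m × Qubits n) × Qubits k where
  toFun x := ((fun i => x.1 (Fin.castAdd k i), x.2), fun j => x.1 (Fin.natAdd m j))
  invFun y := (Fin.append y.1.1 y.2, y.1.2)
  left_inv x := by
    refine Prod.ext (funext fun i => ?_) rfl
    refine Fin.addCases (fun i => ?_) (fun j => ?_) i <;> simp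
  right_inv y := by simp

/-- The operator that applies `V e` to the first `m` auxiliary qubits and the `n` system qubits
when the `k` extra auxiliary qubits are in the basis state `e`. -/
def multiplexed {m k n : ℕ}
    (V : Qubits k → Matrix (Qubits m × Qubits n) (Qubits m × Qubits n) ℂ) :
    Matrix (Qubits (m + k) × Qubits n) (Qubits (m + k) × Qubits n) ℂ :=
  (Matrix.blockDiagonal V).submatrix (regroup m k n) (regroup m k n)

/-- The gates of a circuit on `m + k` auxiliary and `n` system qubits with access to an oracle `U`
acting on the first `m` auxiliary and the `n` system qubits: a fixed unitary that does not involve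
the oracle, a call to `U` or `U†`, or a call to `U` or `U†` controlled by the extra auxiliary
qubit `c` (the oracle acts if qubit `c` is in state one). -/
inductive Gate (m k n : ℕ) : Type
  | fixed (V : Matrix.unitaryGroup (Qubits (m + k) × Qubits n) ℂ) : Gate m k n
  | call : Gate m k n
  | callAdj : Gate m k n
  | ctrlCall (c : Fin k) : Gate m k n
  | ctrlCallAdj (c : Fin k) : Gate m k n

/-- The operator implemented by a gate when the oracle is `U`. -/
def Gate.eval {m k n : ℕ} (U : Matrix (Qubits m × Qubits n) (Qubits m × Qubits n) ℂ) :
    Gate m k n → Matrix (Qubits (m + k) × Qubits n) (Qubits (m + k) × Qubits n) ℂ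
  | .fixed V => V
  | .call => multiplexed fun _ => U
  | .callAdj => multiplexed fun _ => star U
  | .ctrlCall c => multiplexed fun e => if e c = 1 then U else 1
  | .ctrlCallAdj c => multiplexed fun e => if e c = 1 then star U else 1

/-- The number of oracle calls made by a gate. -/
def Gate.calls {m k n : ℕ} : Gate m k n → ℕ
  | .fixed _ => 0
  | .call => 1
  | .callAdj => 1
  | .ctrlCall _ => 1
  | .ctrlCallAdj _ => 1

/-- A query circuit: a finite sequence of gates, listed in the order in which they are applied. -/
abbrev QueryCircuit (m k n : ℕ) : Type := List (Gate m k n)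

/-- The operator implemented by a query circuit when the oracle is `U`. -/
def QueryCircuit.eval {m k n : ℕ} (U : Matrix (Qubits m × Qubits n) (Qubits m × Qubits n) ℂ) :
    QueryCircuit m k n → Matrix (Qubits (m + k) × Qubits n) (Qubits (m + k) × Qubits n) ℂ
  | [] => 1
  | g :: C => QueryCircuit.eval U C * g.eval U

/-- The number of oracle calls made by a query circuit. -/
def QueryCircuit.calls {m k n : ℕ} (C : QueryCircuit m k n) : ℕ := (C.map Gate.calls).sum

/-- The constant `c = 4 / (√(2π) e^{1/13})`. -/
noncomputable def hamSimConst : ℝ := 4 / (√(2 * Real.pi) * Real.exp (1 / 13))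

/-! Put `t = α * τ`. The encoded block `K = H / α` is Hermitian with norm at most 1, and `exp (-iHτ)
= exp (-itK)`. It therefore suffices to approximate `exp (-itx)` on `[-1, 1]` by a polynomial `p`,
to implement `p(K)`, and to control the errors.

Interpolation at `R` Chebyshev nodes, where `R` is the ceiling in the statement, gives `p` of degree
at most `R - 1`. Stirling's formula and `(x/q)^q ≤ exp (x - q)` turn its error into `ε ≤ 0.275 δ`
(`exists_polynomial_approx_exp`, `approximation_error_le`).

The block `p(K)/2` then costs `R` calls (`exists_implementable_half`). With `Z` the reflection about
the zero ancilla state, the walk `W = Z U† Z U` satisfies `(2 + W + W†)/4 · J = J K²`, so the even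
and odd parts of `p` become Laurent polynomials in `W`. The parallelogram law at `±√s` bounds both
parts jointly, so mixed parity costs no further normalization. Fejér–Riesz completes the two to a
unit vector of polynomials on the circle. Layer stripping factors that vector into degree-one steps
`1 + (W - 1) u u†`. Each step costs a single uncontrolled call, because `ZU` and `UZ` differ by
exactly one walk step, and a controlled `Z` before or after the call selects between them. One last
controlled call aligns the two parities.

The factor `1/2` is `sin 30°`, so a single round of oblivious amplitude amplification removes it,
using the circuit three times. The amplified block `(3A - A A† A)/2` fixes unitaries and does not
enlarge an error `ε` to first order (`norm_amplified_sub_le`). For `δ ≥ 1` a zero block already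
suffices. -/

/-! ### Chebyshev interpolation of the exponential -/

open Polynomial in
/-- Rolle's theorem for finitely many zeros. -/
theorem exists_finset_deriv_eq_zero {f f' : ℝ → ℝ} (hf : ∀ x, HasDerivAt f (f' x) x) {n : ℕ}
    {s : Finset ℝ} (hs : s.card = n + 1) (h0 : ∀ x ∈ s, f x = 0) :
    ∃ s' : Finset ℝ, s'.card = n ∧ ∀ x ∈ s', f' x = 0 := by
  have key : ∀ i : Fin n, ∃ y, s.orderEmbOfFin hs i.castSucc < y ∧
      y < s.orderEmbOfFin hs i.succ ∧ f' y = 0 := by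
    intro i
    have hlt : s.orderEmbOfFin hs i.castSucc < s.orderEmbOfFin hs i.succ :=
      (s.orderEmbOfFin hs).strictMono i.castSucc_lt_succ
    obtain ⟨y, hy, h⟩ := exists_hasDerivAt_eq_zero hlt
      (fun x _ => (hf x).continuousAt.continuousWithinAt)
      (by rw [h0 _ (s.orderEmbOfFin_mem hs _), h0 _ (s.orderEmbOfFin_mem hs _)])
      (fun x _ => hf x)
    exact ⟨y, hy.1, hy.2, h⟩
  choose y hy1 hy2 hy3 using key
  have hmono : StrictMono y := fun i j hij =>
    (hy2 i).trans_le <| ((s.orderEmbOfFin hs).monotone (Fin.succ_le_castSucc_iff.2 hij)).trans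
      (hy1 j).le
  refine ⟨Finset.univ.image y, ?_, ?_⟩
  · rw [Finset.card_image_of_injective _ hmono.injective, Finset.card_univ, Fintype.card_fin]
  · intro x hx
    obtain ⟨i, -, rfl⟩ := Finset.mem_image.1 hx
    exact hy3 i

open Polynomial in
/-- If a polynomial of degree at most `n` agrees with a sinusoid in `n + 1` points, then its
coefficient of degree `n` is controlled. -/
theorem abs_coeff_mul_factorial_le_of_eq_cos (t : ℝ) (n : ℕ) : ∀ (A φ : ℝ) (P : ℝ[X]),
    P.natDegree ≤ n → ∀ s : Finset ℝ, s.card = n + 1 →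
    (∀ x ∈ s, A * Real.cos (φ - t * x) = P.eval x) →
    |P.coeff n| * n.factorial ≤ |A| * |t| ^ n := by
  induction n with
  | zero =>
    intro A φ P hP s hs h
    obtain ⟨x, hx⟩ := Finset.card_pos.1 (by omega : 0 < s.card)
    have hx' := h x hx
    rw [eq_C_of_natDegree_le_zero hP, eval_C] at hx'
    rw [← hx', abs_mul]
    simpa using mul_le_mul_of_nonneg_left (Real.abs_cos_le_one _) (abs_nonneg A)
  | succ n ih =>
    intro A φ P hP s hs h
    -- Differentiation preserves the shape of the problem: a sinusoid stays a sinusoid, with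
    -- amplitude multiplied by `t` and phase shifted by `π/2`, while Rolle costs one zero and `P`
    -- loses one degree.
    have hd : ∀ x, HasDerivAt (fun x => A * Real.cos (φ - t * x) - P.eval x)
        (A * t * Real.cos (φ - Real.pi / 2 - t * x) - (derivative P).eval x) x := by
      intro x
      have h1 : HasDerivAt (fun x => φ - t * x) (-t) x := by
        simpa using ((hasDerivAt_id x).const_mul t).const_sub φ
      have h2 := (h1.cos.const_mul A).sub (P.hasDerivAt x)
      convert! h2 using 2
      rw [show φ - Real.pi / 2 - t * x = (φ - t * x) - Real.pi / 2 by ring, Real.cos_sub_pi_div_two]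
      ring
    obtain ⟨s', hs', h'⟩ := exists_finset_deriv_eq_zero hd hs
      (fun x hx => sub_eq_zero.2 (h x hx))
    have := ih (A * t) (φ - Real.pi / 2) (derivative P)
      ((natDegree_derivative_le P).trans (by omega)) s' hs' (fun x hx => sub_eq_zero.1 (h' x hx))
    rw [coeff_derivative, abs_mul, abs_mul] at this
    rw [Nat.factorial_succ, pow_succ]
    have h3 : |(n : ℝ) + 1| = n + 1 := abs_of_nonneg (by positivity)
    rw [h3] at this
    push_cast
    linarith

open Polynomial in
/-- Interpolation in the Chebyshev nodes: `exp (-i t x)` is approximated on `[-1, 1]` by a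
polynomial of degree less than `q` with error at most `2 (|t| / 2) ^ q / q!`. -/
theorem exists_polynomial_approx_exp (t : ℝ) {q : ℕ} (hq : 0 < q) :
    ∃ p : ℂ[X], p.degree < q ∧ ∀ x : ℝ, |x| ≤ 1 →
      ‖Complex.exp (-(Complex.I * t) * x) - p.eval (x : ℂ)‖ ≤
        2 * (|t| / 2) ^ q / q.factorial := by
  set T := Chebyshev.T ℝ (q : ℤ) with hT
  set s : Finset ℝ := (Finset.range q).image
    (fun k : ℕ => Real.cos ((2 * k + 1) * Real.pi / (2 * q))) with hs
  have hroots : T.roots = s.val := Chebyshev.roots_T_real q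
  have hscard : s.card = q := by
    rw [hs, Finset.card_image_of_injOn, Finset.card_range]
    intro i hi j hj hij
    exact Multiset.inj_on_of_nodup_map (Chebyshev.roots_T_real_nodup q) i (Finset.mem_def.1 hi) j
      (Finset.mem_def.1 hj) hij
  have hTs : ∀ x, T.eval x = 0 ↔ x ∈ s := by
    intro x
    have hT0 : T ≠ 0 := by
      intro h
      have := Chebyshev.natDegree_T ℝ (q : ℤ)
      rw [← hT, h] at this
      simp at this
      omega
    rw [← Finset.mem_val, ← hroots, mem_roots hT0]; rfl
  have hTdeg : T.natDegree = q := Chebyshev.natDegree_T ℝ (q : ℤ)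
  have hTlc : T.coeff q = 2 ^ (q - 1) := by
    have := Chebyshev.leadingCoeff_T ℝ (q : ℤ)
    rw [← hT, leadingCoeff, hTdeg] at this
    simpa using this
  set a := Lagrange.interpolate s id (fun x => Real.cos (t * x)) with ha
  set b := Lagrange.interpolate s id (fun x => Real.sin (t * x)) with hb
  have hinj : Set.InjOn (id : ℝ → ℝ) s := Function.injective_id.injOn
  have had : a.degree < q := hscard ▸ Lagrange.degree_interpolate_lt _ hinj
  have hbd : b.degree < q := hscard ▸ Lagrange.degree_interpolate_lt _ hinj
  have hae : ∀ x ∈ s, a.eval x = Real.cos (t * x) := fun x hx =>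
    Lagrange.eval_interpolate_at_node (v := id) _ hinj hx
  have hbe : ∀ x ∈ s, b.eval x = Real.sin (t * x) := fun x hx =>
    Lagrange.eval_interpolate_at_node (v := id) _ hinj hx
  have real_bound : ∀ φ x : ℝ, |x| ≤ 1 →
      |Real.cos φ * (Real.cos (t * x) - a.eval x) + Real.sin φ * (Real.sin (t * x) - b.eval x)| ≤
        2 * (|t| / 2) ^ q / q.factorial := by
    intro φ x hx
    by_cases hxs : x ∈ s
    · rw [hae x hxs, hbe x hxs]
      simp only [sub_self, mul_zero, add_zero, abs_zero]
      positivity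
    have hTx : T.eval x ≠ 0 := fun h => hxs ((hTs x).1 h)
    set g := Real.cos φ * (Real.cos (t * x) - a.eval x) +
      Real.sin φ * (Real.sin (t * x) - b.eval x) with hg
    -- With this multiple of `T`, which vanishes at the nodes, `P` matches `cos (φ - t y)` at `x` as
    -- well. That makes `q + 1` points, and the leading coefficient `c * 2 ^ (q - 1)` is bounded.
    set c := g / T.eval x with hc
    set P := C (Real.cos φ) * a + C (Real.sin φ) * b + C c * T with hP
    have hPdeg : P.natDegree ≤ q := by
      refine natDegree_add_le_of_degree_le (natDegree_add_le_of_degree_le ?_ ?_) ?_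
      · exact (natDegree_C_mul_le _ _).trans (natDegree_le_of_degree_le had.le)
      · exact (natDegree_C_mul_le _ _).trans (natDegree_le_of_degree_le hbd.le)
      · exact (natDegree_C_mul_le _ _).trans hTdeg.le
    have hPc : P.coeff q = c * 2 ^ (q - 1) := by
      simp only [hP, coeff_add, coeff_C_mul, hTlc, coeff_eq_zero_of_degree_lt had,
        coeff_eq_zero_of_degree_lt hbd]
      ring
    have hbnd := abs_coeff_mul_factorial_le_of_eq_cos t q 1 φ P hPdeg (insert x s)
      (by rw [Finset.card_insert_of_notMem hxs, hscard]) (by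
        intro y hy
        rw [one_mul, Real.cos_sub]
        rcases Finset.mem_insert.1 hy with rfl | hy
        · simp only [hP, eval_add, eval_mul, eval_C, hc, div_mul_cancel₀ _ hTx, hg]
          ring
        · simp only [hP, eval_add, eval_mul, eval_C, hae y hy, hbe y hy, (hTs y).2 hy]
          ring)
    rw [hPc, abs_mul, abs_one, one_mul, abs_of_pos (by positivity : (0 : ℝ) < 2 ^ (q - 1))] at hbnd
    have hgc : |g| ≤ |c| := by
      have : g = c * T.eval x := by rw [hc, div_mul_cancel₀ _ hTx]
      rw [this, abs_mul]
      exact mul_le_of_le_one_right (abs_nonneg _) (Chebyshev.abs_eval_T_real_le_one _ hx)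
    refine hgc.trans ?_
    rw [le_div_iff₀ (by positivity), div_pow]
    obtain ⟨r, rfl⟩ : ∃ r, q = r + 1 := ⟨q - 1, by omega⟩
    rw [Nat.add_sub_cancel] at hbnd
    rw [pow_succ 2, ← div_div, mul_div_cancel₀ _ (two_ne_zero' ℝ), le_div_iff₀ (by positivity)]
    linarith
  refine ⟨a.map (algebraMap ℝ ℂ) - C Complex.I * b.map (algebraMap ℝ ℂ), ?_, ?_⟩
  · refine (degree_sub_le _ _).trans_lt (max_lt ?_ ?_)
    · exact degree_map_le.trans_lt had
    · rw [← smul_eq_C_mul]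
      exact (degree_smul_le _ _).trans_lt (degree_map_le.trans_lt hbd)
  · intro x hx
    set u : ℂ := ⟨Real.cos (t * x) - a.eval x, Real.sin (t * x) - b.eval x⟩ with hu
    have h1 : Complex.exp (-(Complex.I * t) * x) -
        (a.map (algebraMap ℝ ℂ) - C Complex.I * b.map (algebraMap ℝ ℂ)).eval (x : ℂ) =
        (starRingEnd ℂ) u := by
      have e1 : (a.map (algebraMap ℝ ℂ)).eval (x : ℂ) = (a.eval x : ℝ) :=
        eval_map_algebraMap a (x : ℂ) |>.trans (aeval_algebraMap_apply_eq_algebraMap_eval x a)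
      have e2 : (b.map (algebraMap ℝ ℂ)).eval (x : ℂ) = (b.eval x : ℝ) :=
        eval_map_algebraMap b (x : ℂ) |>.trans (aeval_algebraMap_apply_eq_algebraMap_eval x b)
      rw [eval_sub, eval_mul, eval_C, e1, e2,
        show -(Complex.I * t) * x = ((-(t * x) : ℝ) : ℂ) * Complex.I by push_cast; ring,
        Complex.exp_mul_I, ← Complex.ofReal_cos, ← Complex.ofReal_sin, Real.cos_neg, Real.sin_neg]
      rw [hu]
      generalize Real.cos (t * x) = c
      generalize Real.sin (t * x) = d
      apply Complex.ext
      · simp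
      · simp
        ring
    rw [h1, RCLike.norm_conj]
    -- Taking the phase to be the argument of the error bounds its modulus directly, without the
    -- factor `√2` lost by treating cosine and sine separately.
    have h2 := real_bound u.arg x hx
    have h3 := Complex.norm_mul_cos_arg u
    have h4 := Complex.norm_mul_sin_arg u
    have h5 : Real.cos u.arg * u.re + Real.sin u.arg * u.im = ‖u‖ := by
      rw [← h3, ← h4]
      linear_combination ‖u‖ * Real.cos_sq_add_sin_sq u.arg
    calc ‖u‖ = |Real.cos u.arg * u.re + Real.sin u.arg * u.im| := by
          rw [h5, abs_of_nonneg (norm_nonneg _)]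
      _ ≤ _ := h2

/-! ### Polynomials on the unit circle and Fejér–Riesz factorization -/

theorem infinite_setOf_norm_eq_one : {z : ℂ | ‖z‖ = 1}.Infinite := by
  have h := (isPreconnected_sphere (E := ℂ) (by simp [Complex.rank_real_complex]) 0 1)
  have h2 : (Metric.sphere (0 : ℂ) 1).Nontrivial := ⟨1, by simp, -1, by simp, by norm_num⟩
  have := h.infinite_of_nontrivial h2
  convert! this using 1
  ext z
  simp

theorem mul_conj_of_norm_eq_one {z : ℂ} (hz : ‖z‖ = 1) : z * (starRingEnd ℂ) z = 1 := by
  rw [Complex.mul_conj, Complex.normSq_eq_norm_sq, hz]; simp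

open Polynomial in
theorem eq_of_eval_eq_on_circle {F G : ℂ[X]} (h : ∀ z : ℂ, ‖z‖ = 1 → F.eval z = G.eval z) :
    F = G :=
  eq_of_infinite_eval_eq F G (infinite_setOf_norm_eq_one.mono fun z hz => h z hz)

open Polynomial in
-- Reversing and conjugating the coefficients gives `w ^ N * conj (F (1 / conj w))`. On the circle
-- this makes conjugation a polynomial operation; off it, it pairs the point `z` with `1 / conj z`.
theorem eval_reflect_map_conj {z : ℂ} (hz : z ≠ 0) {N : ℕ} {F : ℂ[X]} (hF : F.natDegree ≤ N) :
    (reflect N (F.map (starRingEnd ℂ))).eval ((starRingEnd ℂ) z)⁻¹ * (starRingEnd ℂ) z ^ N =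
      (starRingEnd ℂ) (F.eval z) := by
  have hz' : (starRingEnd ℂ) z ≠ 0 := (_root_.map_ne_zero _).2 hz
  let _ := invertibleOfNonzero hz'
  have := eval₂_reflect_mul_pow (RingHom.id ℂ) ((starRingEnd ℂ) z) N (F.map (starRingEnd ℂ))
    (natDegree_map_le.trans hF)
  rw [invOf_eq_inv] at this
  rw [← eval_map_apply]
  exact this

open Polynomial in
theorem eval_reflect_map_conj_of_norm_eq_one {z : ℂ} (hz : ‖z‖ = 1) {N : ℕ} {F : ℂ[X]}
    (hF : F.natDegree ≤ N) :
    (reflect N (F.map (starRingEnd ℂ))).eval z = z ^ N * (starRingEnd ℂ) (F.eval z) := by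
  have hz0 : z ≠ 0 := by rintro rfl; simp at hz
  have h := eval_reflect_map_conj hz0 hF
  have h1 := mul_conj_of_norm_eq_one hz
  rw [← eq_inv_of_mul_eq_one_left h1] at h
  rw [← h, mul_comm, mul_assoc, ← mul_pow, mul_comm ((starRingEnd ℂ) z), h1, one_pow, mul_one]

open Polynomial in
/-- **Fejér–Riesz factorization** of a trigonometric polynomial that is strictly positive on the
unit circle. -/
theorem exists_fejer_riesz (D : ℕ) : ∀ G : ℂ[X], G.natDegree ≤ 2 * D →
    (∀ z : ℂ, ‖z‖ = 1 → ∃ r : ℝ, 0 < r ∧ G.eval z = z ^ D * r) →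
    ∃ B : ℂ[X], B.natDegree ≤ D ∧
      ∀ z : ℂ, ‖z‖ = 1 → G.eval z = z ^ D * ((‖B.eval z‖ ^ 2 : ℝ) : ℂ) := by
  induction D with
  | zero =>
    intro G hG hpos
    obtain ⟨r, hr, h1⟩ := hpos 1 (by simp)
    rw [eq_C_of_natDegree_le_zero hG, eval_C, pow_zero, one_mul] at h1
    refine ⟨C (√r : ℂ), by simp, fun z _ => ?_⟩
    rw [eq_C_of_natDegree_le_zero hG, eval_C, h1, eval_C, Complex.norm_real, Real.norm_eq_abs,
      sq_abs, Real.sq_sqrt hr.le, pow_zero, one_mul]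
  | succ D ih =>
    intro G hG hpos
    have hsym : G = reflect (2 * (D + 1)) (G.map (starRingEnd ℂ)) := by
      refine eq_of_eval_eq_on_circle fun z hz => ?_
      obtain ⟨r, -, hr⟩ := hpos z hz
      rw [eval_reflect_map_conj_of_norm_eq_one hz hG, hr, map_mul, map_pow, Complex.conj_ofReal]
      have h1 : z ^ (D + 1) * (starRingEnd ℂ) z ^ (D + 1) = 1 := by
        rw [← mul_pow, mul_conj_of_norm_eq_one hz, one_pow]
      linear_combination (-(z ^ (D + 1)) * r) * h1
    have hcoeff : G.coeff (2 * (D + 1)) = (starRingEnd ℂ) (G.coeff 0) := by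
      conv_lhs => rw [hsym]
      rw [coeff_reflect, coeff_map, revAt_le le_rfl, Nat.sub_self]
    -- By the symmetry the constant and top coefficients vanish together, so dividing by `X` lowers
    -- the degree bound by two.
    by_cases h0 : G.coeff 0 = 0
    · have hGX : G = G.divX * X := by
        conv_lhs => rw [← divX_mul_X_add G, h0, C_0, add_zero]
      have hdeg : G.divX.natDegree ≤ 2 * D := by
        rw [natDegree_divX_eq_natDegree_tsub_one]
        have : G.natDegree ≠ 2 * (D + 1) := by
          intro h
          have hlc : G.leadingCoeff = 0 := by rw [leadingCoeff, h, hcoeff, h0, map_zero]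
          rw [leadingCoeff_eq_zero.1 hlc] at h
          simp at h
        omega
      have hev : ∀ z, G.eval z = G.divX.eval z * z := fun z => by
        conv_lhs => rw [hGX, eval_mul, eval_X]
      obtain ⟨B, hB, hBe⟩ := ih G.divX hdeg (by
        intro z hz
        obtain ⟨r, hr, h⟩ := hpos z hz
        have hz0 : z ≠ 0 := by rintro rfl; simp at hz
        refine ⟨r, hr, mul_right_cancel₀ hz0 ?_⟩
        rw [← hev, h]; ring)
      refine ⟨B, hB.trans (by omega), fun z hz => ?_⟩
      rw [hev, hBe z hz]; ring
    · have hdeg : G.natDegree = 2 * (D + 1) := by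
        refine le_antisymm hG (le_natDegree_of_ne_zero ?_)
        rw [hcoeff]
        exact (_root_.map_ne_zero _).2 h0
      obtain ⟨r, hr⟩ := Complex.exists_root (f := G)
        (natDegree_pos_iff_degree_pos.1 (by omega))
      have hr0 : r ≠ 0 := by
        rintro rfl
        exact h0 (by rw [coeff_zero_eq_eval_zero]; exact hr)
      have hrc : (starRingEnd ℂ) r ≠ 0 := (_root_.map_ne_zero _).2 hr0
      have hr1 : ‖r‖ ≠ 1 := by
        intro h
        obtain ⟨ρ, hρ, hρ'⟩ := hpos r h
        rw [hr.eq_zero] at hρ'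
        exact mul_ne_zero (pow_ne_zero _ hr0) (Complex.ofReal_ne_zero.2 hρ.ne') hρ'.symm
      obtain ⟨G1, hG1⟩ := dvd_iff_isRoot.2 hr
      have hs : G.eval ((starRingEnd ℂ) r)⁻¹ = 0 := by
        have h := eval_reflect_map_conj hr0 hG
        rw [← hsym, hr.eq_zero, map_zero] at h
        exact (mul_eq_zero.1 h).resolve_right (pow_ne_zero _ hrc)
      have hs1 : G1.IsRoot ((starRingEnd ℂ) r)⁻¹ := by
        rw [hG1, eval_mul, eval_sub, eval_X, eval_C] at hs
        refine (mul_eq_zero.1 hs).resolve_left fun h => hr1 ?_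
        have h2 : r * (starRingEnd ℂ) r = 1 := by
          nth_rewrite 1 [← sub_eq_zero.1 h]
          exact inv_mul_cancel₀ hrc
        rw [Complex.mul_conj, Complex.normSq_eq_norm_sq] at h2
        have h3 : ‖r‖ ^ 2 = 1 := by exact_mod_cast h2
        exact (pow_eq_one_iff_of_nonneg (norm_nonneg _) two_ne_zero).1 h3
      obtain ⟨G2, hG2⟩ := dvd_iff_isRoot.2 hs1
      have hG20 : G2 ≠ 0 := by
        rintro rfl
        rw [hG1, hG2] at hdeg
        simp at hdeg
      have hdeg2 : G2.natDegree = 2 * D := by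
        rw [hG1, hG2, natDegree_mul (X_sub_C_ne_zero _) (mul_ne_zero (X_sub_C_ne_zero _) hG20),
          natDegree_mul (X_sub_C_ne_zero _) hG20, natDegree_X_sub_C, natDegree_X_sub_C] at hdeg
        omega
      -- The paired roots `r` and `1 / conj r` contribute `-(1 / conj r) * z * |z - r|²` on the
      -- circle. Removing them keeps positivity and puts a factor `X - r` into `B`.
      have hev : ∀ z : ℂ, ‖z‖ = 1 → G.eval z =
          z * ((‖z - r‖ ^ 2 : ℝ) : ℂ) * (C (-((starRingEnd ℂ) r)⁻¹) * G2).eval z := by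
        intro z hz
        rw [← Complex.normSq_eq_norm_sq, ← Complex.mul_conj, hG1, hG2]
        simp only [eval_mul, eval_sub, eval_X, eval_C, map_sub]
        field_simp
        linear_combination ((z - r) * eval z G2) * mul_conj_of_norm_eq_one hz
      have hzr : ∀ z : ℂ, ‖z‖ = 1 → 0 < ‖z - r‖ ^ 2 := by
        intro z hz
        refine pow_pos (norm_pos_iff.2 (sub_ne_zero.2 ?_)) 2
        rintro rfl
        exact hr1 hz
      obtain ⟨B, hB, hBe⟩ := ih (C (-((starRingEnd ℂ) r)⁻¹) * G2)
        ((natDegree_C_mul_le _ _).trans hdeg2.le) (by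
          intro z hz
          obtain ⟨ρ, hρ, h⟩ := hpos z hz
          have hz0 : z ≠ 0 := by rintro rfl; simp at hz
          have hne : z * ((‖z - r‖ ^ 2 : ℝ) : ℂ) ≠ 0 :=
            mul_ne_zero hz0 (Complex.ofReal_ne_zero.2 (hzr z hz).ne')
          refine ⟨ρ / ‖z - r‖ ^ 2, div_pos hρ (hzr z hz), mul_left_cancel₀ hne ?_⟩
          rw [← hev z hz, h]
          have := (hzr z hz).ne'
          have h2 : ((‖z - r‖ ^ 2 : ℝ) : ℂ) ≠ 0 := Complex.ofReal_ne_zero.2 this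
          rw [Complex.ofReal_div]
          field_simp
          ring)
      refine ⟨(X - C r) * B, ?_, fun z hz => ?_⟩
      · refine natDegree_mul_le.trans ?_
        rw [natDegree_X_sub_C]
        omega
      · rw [hev z hz, hBe z hz, eval_mul, norm_mul, eval_sub, eval_X, eval_C]
        push_cast
        ring

/-! ### Layer stripping -/

open Polynomial in
/-- Multiplication of a vector of polynomials by `1 + (X - 1) u u†`. -/
noncomputable def vecStep {ι : Type*} [Fintype ι] (u : ι → ℂ) (p : ι → ℂ[X]) : ι → ℂ[X] :=
  fun i => p i + (X - 1) * (C (u i) * ∑ j, C ((starRingEnd ℂ) (u j)) * p j)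

open Polynomial in
-- The norm condition says that `∑ p i` times its reflection is `X ^ (D + 1)`; the sum in question
-- is the coefficient of degree `2 (D + 1)`.
theorem sum_leading_mul_conj_coeff_zero {ι : Type*} [Fintype ι] {D : ℕ} {p : ι → ℂ[X]}
    (hdeg : ∀ i, (p i).natDegree ≤ D + 1)
    (hnorm : ∀ z : ℂ, ‖z‖ = 1 → ∑ i, (p i).eval z * (starRingEnd ℂ) ((p i).eval z) = 1) :
    ∑ i, (p i).coeff (D + 1) * (starRingEnd ℂ) ((p i).coeff 0) = 0 := by
  have h : ∑ i, p i * reflect (D + 1) ((p i).map (starRingEnd ℂ)) = X ^ (D + 1) := by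
    refine eq_of_eval_eq_on_circle fun z hz => ?_
    rw [eval_finsetSum, eval_pow, eval_X, ← mul_one (z ^ (D + 1)), ← hnorm z hz, Finset.mul_sum]
    refine Finset.sum_congr rfl fun i _ => ?_
    rw [eval_mul, eval_reflect_map_conj_of_norm_eq_one hz (hdeg i)]
    ring
  have h2 := congrArg (fun q => coeff q (D + 1 + (D + 1))) h
  simp only [finsetSum_coeff, coeff_X_pow] at h2
  rw [if_neg (by omega)] at h2
  rw [← h2]
  refine Finset.sum_congr rfl fun i _ => ?_
  rw [coeff_mul_add_eq_of_natDegree_le (hdeg i), coeff_reflect, coeff_map, revAt_le le_rfl,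
    Nat.sub_self]
  exact natDegree_reflect_le.trans (max_le le_rfl (natDegree_map_le.trans (hdeg i)))

open Polynomial in
-- The direction is the normalized vector of top coefficients, orthogonal to the constant
-- coefficients by the norm condition. The vanishing component `i₀` gives a direction when all top
-- coefficients are zero, and the last conjunct lets it survive the step.
theorem exists_stripping_direction {ι : Type*} [Fintype ι] [DecidableEq ι] {D : ℕ}
    {p : ι → ℂ[X]} {i₀ : ι} (hi₀ : p i₀ = 0) (hdeg : ∀ i, (p i).natDegree ≤ D + 1)
    (hnorm : ∀ z : ℂ, ‖z‖ = 1 → ∑ i, (p i).eval z * (starRingEnd ℂ) ((p i).eval z) = 1) :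
    ∃ (u : ι → ℂ) (c : ℂ), ∑ i, (starRingEnd ℂ) (u i) * u i = 1 ∧
      (∀ i, (p i).coeff (D + 1) = u i * c) ∧
      ∑ i, (starRingEnd ℂ) (u i) * (p i).coeff 0 = 0 ∧
      C (u i₀) * ∑ j, C ((starRingEnd ℂ) (u j)) * p j = 0 := by
  by_cases h : ∀ i, (p i).coeff (D + 1) = 0
  -- An idle step: it acts only on the zero component, but it keeps the number of calls exact.
  · refine ⟨Pi.single i₀ 1, 0, ?_, ?_, ?_, ?_⟩
    · simp [Pi.single_apply]
    · simpa using h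
    · simp [Pi.single_apply, hi₀]
    · simp [Pi.single_apply, hi₀]
  · have horth := sum_leading_mul_conj_coeff_zero hdeg hnorm
    set N : ℝ := ∑ i, ‖(p i).coeff (D + 1)‖ ^ 2 with hN
    have hNpos : 0 < N := by
      push Not at h
      obtain ⟨i, hi⟩ := h
      exact Finset.sum_pos' (fun i _ => by positivity) ⟨i, Finset.mem_univ _, by positivity⟩
    have hs : (√N : ℂ) ≠ 0 := Complex.ofReal_ne_zero.2 (Real.sqrt_pos.2 hNpos).ne'
    have hss : (√N : ℂ) * √N = N := by
      rw [← Complex.ofReal_mul, Real.mul_self_sqrt hNpos.le]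
    refine ⟨fun i => (p i).coeff (D + 1) / √N, √N, ?_, ?_, ?_, ?_⟩
    · have : ∀ i, (starRingEnd ℂ) ((p i).coeff (D + 1) / √N) * ((p i).coeff (D + 1) / √N) =
          ((‖(p i).coeff (D + 1)‖ ^ 2 : ℝ) : ℂ) / N := by
        intro i
        rw [map_div₀, Complex.conj_ofReal, div_mul_div_comm, hss, mul_comm, Complex.mul_conj,
          Complex.normSq_eq_norm_sq]
      simp only [this]
      rw [← Finset.sum_div, ← Complex.ofReal_sum, ← hN,
        div_self (Complex.ofReal_ne_zero.2 hNpos.ne')]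
    · intro i
      rw [div_mul_cancel₀ _ hs]
    · have h2 := congrArg (starRingEnd ℂ) horth
      simp only [map_sum, map_mul, Complex.conj_conj, map_zero] at h2
      simp only [map_div₀, Complex.conj_ofReal, div_mul_eq_mul_div]
      rw [← Finset.sum_div, h2, zero_div]
    · simp [hi₀]

open Polynomial in
/-- Layer stripping: a vector of polynomials of degree at most `D + 1` with unit norm on the unit
circle is obtained by one step from such a vector of degree at most `D`. -/
theorem exists_vecStep_eq {ι : Type*} [Fintype ι] [DecidableEq ι] {D : ℕ}
    {p : ι → ℂ[X]} {i₀ : ι} (hi₀ : p i₀ = 0) (hdeg : ∀ i, (p i).natDegree ≤ D + 1)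
    (hnorm : ∀ z : ℂ, ‖z‖ = 1 → ∑ i, (p i).eval z * (starRingEnd ℂ) ((p i).eval z) = 1) :
    ∃ (u : ι → ℂ) (p' : ι → ℂ[X]), ∑ i, (starRingEnd ℂ) (u i) * u i = 1 ∧ p = vecStep u p' ∧
      p' i₀ = 0 ∧ (∀ i, (p' i).natDegree ≤ D) ∧
      ∀ z : ℂ, ‖z‖ = 1 → ∑ i, (p' i).eval z * (starRingEnd ℂ) ((p' i).eval z) = 1 := by
  obtain ⟨u, c, hu, htop, hbot, hui₀⟩ := exists_stripping_direction hi₀ hdeg hnorm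
  set f := ∑ j, C ((starRingEnd ℂ) (u j)) * p j with hf
  have hf0 : f.coeff 0 = 0 := by
    simp only [hf, finsetSum_coeff, coeff_C_mul, hbot]
  have hfX : f = f.divX * X := by
    conv_lhs => rw [← divX_mul_X_add f, hf0, C_0, add_zero]
  have hfdeg : f.natDegree ≤ D + 1 :=
    natDegree_sum_le_of_forall_le _ _ fun i _ => (natDegree_C_mul_le _ _).trans (hdeg i)
  have hftop : f.coeff (D + 1) = c := by
    simp only [hf, finsetSum_coeff, coeff_C_mul, htop]
    simp only [← mul_assoc]
    rw [← Finset.sum_mul, hu, one_mul]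
  have huC : ∑ j, C ((starRingEnd ℂ) (u j)) * C (u j) = 1 := by
    simp only [← C_mul, ← map_sum, hu, C_1]
  have hcirc : ∀ z : ℂ, f.eval z = z * f.divX.eval z := by
    intro z
    conv_lhs => rw [hfX, eval_mul, eval_X, mul_comm]
  -- This is the inverse step `1 + (X⁻¹ - 1) u u†`, polynomial because `X` divides `f`. The degree
  -- drops since both `p i` and `C (u i) * f` have top coefficient `u i * c`.
  set p' : ι → ℂ[X] := fun i => p i - C (u i) * f + C (u i) * f.divX with hp'
  have hp'sum : ∑ j, C ((starRingEnd ℂ) (u j)) * p' j = f.divX := by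
    have : ∀ j, C ((starRingEnd ℂ) (u j)) * p' j = C ((starRingEnd ℂ) (u j)) * p j +
        C ((starRingEnd ℂ) (u j)) * C (u j) * (f.divX - f) := fun j => by
      simp only [hp']; ring
    simp only [this]
    rw [Finset.sum_add_distrib, ← Finset.sum_mul, huC, ← hf]
    ring
  refine ⟨u, p', hu, ?_, ?_, ?_, ?_⟩
  · funext i
    simp only [vecStep, hp'sum]
    simp only [hp']
    linear_combination C (u i) * hfX
  · simp only [hp', hi₀, hui₀, zero_sub, neg_zero, zero_add]
    rcases mul_eq_zero.1 hui₀ with h | h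
    · rw [h, zero_mul]
    · rw [h, divX_zero, mul_zero]
  · intro i
    refine natDegree_add_le_of_degree_le ?_ ?_
    · have h1 : (p i - C (u i) * f).natDegree ≤ D + 1 :=
        (natDegree_sub_le_of_le (hdeg i) ((natDegree_C_mul_le _ _).trans hfdeg)).trans
          (max_self _).le
      have h2 : (p i - C (u i) * f).coeff (D + 1) = 0 := by
        rw [coeff_sub, coeff_C_mul, hftop, htop, sub_self]
      by_contra h
      have h3 : (p i - C (u i) * f).natDegree = D + 1 := by omega
      rw [← h3] at h2
      have h4 := leadingCoeff_eq_zero.1 h2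
      rw [h4] at h3
      simp at h3
    · refine (natDegree_C_mul_le _ _).trans ?_
      rw [natDegree_divX_eq_natDegree_tsub_one]
      omega
  · intro z hz
    rw [← hnorm z hz]
    have e1 : ∑ i, (starRingEnd ℂ) (u i) * (p i).eval z = f.eval z := by
      simp only [hf, eval_finsetSum, eval_mul, eval_C]
    have e2 : ∑ i, u i * (starRingEnd ℂ) ((p i).eval z) = (starRingEnd ℂ) (f.eval z) := by
      rw [← e1, map_sum]
      simp only [map_mul, Complex.conj_conj]
    set d := f.eval z - f.divX.eval z with hd
    have e3 : ∀ i, (p' i).eval z * (starRingEnd ℂ) ((p' i).eval z) =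
        (p i).eval z * (starRingEnd ℂ) ((p i).eval z) -
        (starRingEnd ℂ) d * ((starRingEnd ℂ) (u i) * (p i).eval z) -
        d * (u i * (starRingEnd ℂ) ((p i).eval z)) +
        d * (starRingEnd ℂ) d * ((starRingEnd ℂ) (u i) * u i) := by
      intro i
      have : (p' i).eval z = (p i).eval z - u i * d := by
        simp only [hp', hd, eval_add, eval_sub, eval_mul, eval_C]
        ring
      rw [this, map_sub, map_mul]
      ring
    simp only [e3]
    rw [Finset.sum_add_distrib, Finset.sum_sub_distrib, Finset.sum_sub_distrib, ← Finset.mul_sum,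
      ← Finset.mul_sum, ← Finset.mul_sum, e1, e2, hu, hd, hcirc z]
    simp only [map_sub, map_mul]
    linear_combination (-(eval z f.divX * (starRingEnd ℂ) (eval z f.divX))) *
      mul_conj_of_norm_eq_one hz

open scoped Kronecker Matrix

/-! ### Composition and inversion of query circuits -/

section Circuits

variable {m k n : ℕ}

theorem multiplexed_mul (V W : Qubits k → Matrix (Qubits m × Qubits n) (Qubits m × Qubits n) ℂ) :
    multiplexed V * multiplexed W = multiplexed fun e => V e * W e := by
  rw [multiplexed, multiplexed, Matrix.submatrix_mul_equiv, ← Matrix.blockDiagonal_mul]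
  rfl

theorem star_multiplexed (V : Qubits k → Matrix (Qubits m × Qubits n) (Qubits m × Qubits n) ℂ) :
    star (multiplexed V) = multiplexed fun e => star (V e) := by
  rw [multiplexed, Matrix.star_eq_conjTranspose, Matrix.conjTranspose_submatrix,
    Matrix.blockDiagonal_conjTranspose]
  rfl

theorem multiplexed_one :
    multiplexed (fun _ : Qubits k => (1 : Matrix (Qubits m × Qubits n) (Qubits m × Qubits n) ℂ)) =
      1 := by
  have : Matrix.blockDiagonal (fun _ : Qubits k =>
      (1 : Matrix (Qubits m × Qubits n) (Qubits m × Qubits n) ℂ)) = 1 := Matrix.blockDiagonal_one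
  rw [multiplexed, this, Matrix.submatrix_one_equiv]

theorem multiplexed_mem_unitaryGroup
    {V : Qubits k → Matrix (Qubits m × Qubits n) (Qubits m × Qubits n) ℂ}
    (hV : ∀ e, V e ∈ Matrix.unitaryGroup (Qubits m × Qubits n) ℂ) :
    multiplexed V ∈ Matrix.unitaryGroup (Qubits (m + k) × Qubits n) ℂ := by
  rw [Matrix.mem_unitaryGroup_iff, star_multiplexed, multiplexed_mul]
  simp only [fun e => Matrix.mem_unitaryGroup_iff.1 (hV e), multiplexed_one]

theorem Gate.eval_mem_unitaryGroup
    {U : Matrix (Qubits m × Qubits n) (Qubits m × Qubits n) ℂ}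
    (hU : U ∈ Matrix.unitaryGroup (Qubits m × Qubits n) ℂ) (g : Gate m k n) :
    g.eval U ∈ Matrix.unitaryGroup (Qubits (m + k) × Qubits n) ℂ := by
  have hU' : star U ∈ Matrix.unitaryGroup (Qubits m × Qubits n) ℂ := Unitary.star_mem hU
  cases g with
  | fixed V => exact V.2
  | call => exact multiplexed_mem_unitaryGroup fun _ => hU
  | callAdj => exact multiplexed_mem_unitaryGroup fun _ => hU'
  | ctrlCall c =>
    refine multiplexed_mem_unitaryGroup fun e => ?_
    split_ifs
    exacts [hU, one_mem _]
  | ctrlCallAdj c =>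
    refine multiplexed_mem_unitaryGroup fun e => ?_
    split_ifs
    exacts [hU', one_mem _]

theorem QueryCircuit.eval_mem_unitaryGroup
    {U : Matrix (Qubits m × Qubits n) (Qubits m × Qubits n) ℂ}
    (hU : U ∈ Matrix.unitaryGroup (Qubits m × Qubits n) ℂ) (C : QueryCircuit m k n) :
    C.eval U ∈ Matrix.unitaryGroup (Qubits (m + k) × Qubits n) ℂ := by
  induction C with
  | nil => exact one_mem _
  | cons g C ih => exact mul_mem ih (g.eval_mem_unitaryGroup hU)

theorem QueryCircuit.eval_append (U : Matrix (Qubits m × Qubits n) (Qubits m × Qubits n) ℂ)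
    (C C' : QueryCircuit m k n) :
    QueryCircuit.eval U (C ++ C') = QueryCircuit.eval U C' * QueryCircuit.eval U C := by
  induction C with
  | nil => simp [QueryCircuit.eval]
  | cons g C ih => simp only [List.cons_append, QueryCircuit.eval, ih, mul_assoc]

theorem QueryCircuit.calls_append (C C' : QueryCircuit m k n) :
    QueryCircuit.calls (C ++ C') = C.calls + C'.calls := by
  simp [QueryCircuit.calls]

/-- The inverse gate. -/
noncomputable def Gate.adj : Gate m k n → Gate m k n
  | .fixed V => .fixed (star V)
  | .call => .callAdj
  | .callAdj => .call
  | .ctrlCall c => .ctrlCallAdj c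
  | .ctrlCallAdj c => .ctrlCall c

theorem Gate.eval_adj (U : Matrix (Qubits m × Qubits n) (Qubits m × Qubits n) ℂ)
    (g : Gate m k n) : g.adj.eval U = star (g.eval U) := by
  cases g with
  | fixed V => rfl
  | call => simp only [Gate.adj, Gate.eval, star_multiplexed]
  | callAdj => simp only [Gate.adj, Gate.eval, star_multiplexed, star_star]
  | ctrlCall c =>
    simp only [Gate.adj, Gate.eval, star_multiplexed]
    congr 1
    funext e
    split_ifs <;> simp
  | ctrlCallAdj c =>
    simp only [Gate.adj, Gate.eval, star_multiplexed]
    congr 1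
    funext e
    split_ifs <;> simp

theorem Gate.calls_adj (g : Gate m k n) : g.adj.calls = g.calls := by
  cases g <;> rfl

theorem QueryCircuit.exists_adj (C : QueryCircuit m k n) :
    ∃ C' : QueryCircuit m k n, C'.calls = C.calls ∧
      ∀ U, C'.eval U = star (QueryCircuit.eval U C) := by
  induction C with
  | nil => exact ⟨[], rfl, fun U => by simp [QueryCircuit.eval]⟩
  | cons g C ih =>
    obtain ⟨C', hC', h⟩ := ih
    refine ⟨C' ++ [g.adj], ?_, fun U => ?_⟩
    · rw [QueryCircuit.calls_append, hC']
      simp [QueryCircuit.calls, Gate.calls_adj, add_comm]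
    · rw [QueryCircuit.eval_append, h]
      simp only [QueryCircuit.eval, one_mul, star_mul, Gate.eval_adj]

/-- Operators on the regrouped registers that depend on an oracle. -/
abbrev OracleOperator (m k n : ℕ) : Type :=
  Matrix (Qubits m × Qubits n) (Qubits m × Qubits n) ℂ →
    Matrix ((Qubits m × Qubits n) × Qubits k) ((Qubits m × Qubits n) × Qubits k) ℂ

/-- `Implementable q F`: some circuit with `q` calls implements the operator `F U` for every
unitary oracle `U`, with the registers regrouped. -/
def Implementable (q : ℕ) (F : OracleOperator m k n) : Prop :=
  ∃ C : QueryCircuit m k n, C.calls = q ∧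
    ∀ U ∈ Matrix.unitaryGroup (Qubits m × Qubits n) ℂ,
      C.eval U = (F U).submatrix (regroup m k n) (regroup m k n)

variable {F G : OracleOperator m k n} {q r : ℕ}

theorem Implementable.mul (hF : Implementable q F) (hG : Implementable r G) :
    Implementable (q + r) fun U => F U * G U := by
  obtain ⟨C, hC, h⟩ := hF
  obtain ⟨C', hC', h'⟩ := hG
  refine ⟨C' ++ C, by rw [QueryCircuit.calls_append, hC, hC', add_comm], fun U hU => ?_⟩
  rw [QueryCircuit.eval_append, h U hU, h' U hU, Matrix.submatrix_mul_equiv]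

theorem Implementable.star (hF : Implementable q F) : Implementable q fun U => star (F U) := by
  obtain ⟨C, hC, h⟩ := hF
  obtain ⟨C', hC', h'⟩ := C.exists_adj
  refine ⟨C', hC'.trans hC, fun U hU => ?_⟩
  rw [h', h U hU, Matrix.star_eq_conjTranspose, Matrix.conjTranspose_submatrix]
  rfl

theorem Implementable.congr (hF : Implementable q F)
    (h : ∀ U ∈ Matrix.unitaryGroup (Qubits m × Qubits n) ℂ, F U = G U) : Implementable q G := by
  obtain ⟨C, hC, h'⟩ := hF
  exact ⟨C, hC, fun U hU => by rw [h' U hU, h U hU]⟩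

theorem Implementable.mem_unitaryGroup (hF : Implementable q F)
    {U : Matrix (Qubits m × Qubits n) (Qubits m × Qubits n) ℂ}
    (hU : U ∈ Matrix.unitaryGroup (Qubits m × Qubits n) ℂ) :
    F U ∈ Matrix.unitaryGroup ((Qubits m × Qubits n) × Qubits k) ℂ := by
  obtain ⟨C, -, h⟩ := hF
  have hC := Matrix.mem_unitaryGroup_iff.1 (C.eval_mem_unitaryGroup hU)
  have hinj : Function.Injective fun M : Matrix ((Qubits m × Qubits n) × Qubits k)
      ((Qubits m × Qubits n) × Qubits k) ℂ => M.submatrix (regroup m k n) (regroup m k n) :=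
    (Matrix.reindex (regroup m k n).symm (regroup m k n).symm).injective
  rw [Matrix.mem_unitaryGroup_iff]
  refine hinj ?_
  simp only
  rw [Matrix.submatrix_one_equiv, ← hC, h U hU, Matrix.star_eq_conjTranspose,
    Matrix.star_eq_conjTranspose, Matrix.conjTranspose_submatrix, Matrix.submatrix_mul_equiv]

theorem implementable_fixed
    {M : Matrix ((Qubits m × Qubits n) × Qubits k) ((Qubits m × Qubits n) × Qubits k) ℂ}
    (hM : M ∈ Matrix.unitaryGroup ((Qubits m × Qubits n) × Qubits k) ℂ) :
    Implementable 0 fun _ : Matrix (Qubits m × Qubits n) (Qubits m × Qubits n) ℂ => M := by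
  refine ⟨[.fixed ⟨M.submatrix (regroup m k n) (regroup m k n), ?_⟩], rfl, fun U _ => ?_⟩
  · rw [Matrix.mem_unitaryGroup_iff, Matrix.star_eq_conjTranspose,
      Matrix.conjTranspose_submatrix, Matrix.submatrix_mul_equiv, ← Matrix.star_eq_conjTranspose,
      Matrix.mem_unitaryGroup_iff.1 hM, Matrix.submatrix_one_equiv]
  · simp [QueryCircuit.eval, Gate.eval]

theorem implementable_call :
    Implementable 1 fun U : Matrix (Qubits m × Qubits n) (Qubits m × Qubits n) ℂ =>
      U ⊗ₖ (1 : Matrix (Qubits k) (Qubits k) ℂ) :=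
  ⟨[.call], rfl, fun U _ => by
    simp only [QueryCircuit.eval, Gate.eval, one_mul, multiplexed, Matrix.kronecker_one]⟩

theorem implementable_callAdj :
    Implementable 1 fun U : Matrix (Qubits m × Qubits n) (Qubits m × Qubits n) ℂ =>
      star U ⊗ₖ (1 : Matrix (Qubits k) (Qubits k) ℂ) :=
  ⟨[.callAdj], rfl, fun U _ => by
    simp only [QueryCircuit.eval, Gate.eval, one_mul, multiplexed, Matrix.kronecker_one]⟩

/-- The projection onto the basis states whose qubit `c` is in state one. -/
noncomputable def qubitProj (c : Fin k) : Matrix (Qubits k) (Qubits k) ℂ :=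
  Matrix.diagonal fun e => if e c = 1 then 1 else 0

theorem blockDiagonal_ite (c : Fin k)
    (A B : Matrix (Qubits m × Qubits n) (Qubits m × Qubits n) ℂ) :
    Matrix.blockDiagonal (fun e : Qubits k => if e c = 1 then A else B) =
      A ⊗ₖ qubitProj c + B ⊗ₖ (1 - qubitProj c) := by
  ext ⟨s, e⟩ ⟨s', e'⟩
  simp only [Matrix.blockDiagonal_apply, Matrix.add_apply, Matrix.kronecker_apply, qubitProj,
    Matrix.sub_apply, Matrix.diagonal_apply, Matrix.one_apply]
  by_cases h : e = e'
  · subst h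
    by_cases h1 : e c = 1 <;> simp [h1]
  · simp [h]

theorem implementable_ctrlCall (c : Fin k) :
    Implementable 1 fun U : Matrix (Qubits m × Qubits n) (Qubits m × Qubits n) ℂ =>
      U ⊗ₖ qubitProj c + 1 ⊗ₖ (1 - qubitProj c) :=
  ⟨[.ctrlCall c], rfl, fun U _ => by
    simp only [QueryCircuit.eval, Gate.eval, one_mul, multiplexed, blockDiagonal_ite]⟩

end Circuits

/-! ### Block columns, reflections and amplitude amplification -/

section Blocks

/-- The operator on `σ × ι` with columns in `ν` whose component at `i : ι` is `c i`. -/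
def stack {σ ι ν : Type*} (c : ι → Matrix σ ν ℂ) : Matrix (σ × ι) ν ℂ := fun x j => c x.2 x.1 j

theorem kronecker_mul_stack {σ ι ν : Type*} [Fintype σ] [Fintype ι] (A : Matrix σ σ ℂ)
    (B : Matrix ι ι ℂ) (c : ι → Matrix σ ν ℂ) :
    (A ⊗ₖ B) * stack c = stack fun i => ∑ j, B i j • (A * c j) := by
  ext ⟨s, i⟩ j
  simp only [Matrix.mul_apply, Fintype.sum_prod_type, Matrix.kronecker_apply, stack,
    Matrix.sum_apply, Matrix.smul_apply, smul_eq_mul, Finset.mul_sum]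
  rw [Finset.sum_comm]
  refine Finset.sum_congr rfl fun e _ => Finset.sum_congr rfl fun s' _ => ?_
  ring

theorem stack_add {σ ι ν : Type*} (c d : ι → Matrix σ ν ℂ) :
    stack c + stack d = stack (c + d) := rfl

/-- The isometry given by an injection of basis states. -/
def embMatrix {σ ν : Type*} [DecidableEq σ] (f : ν → σ) : Matrix σ ν ℂ :=
  (1 : Matrix σ σ ℂ).submatrix id f

theorem conjTranspose_embMatrix_mul_mul {σ ν : Type*} [Fintype σ] [DecidableEq σ] (f : ν → σ)
    (M : Matrix σ σ ℂ) : (embMatrix f)ᴴ * M * embMatrix f = M.submatrix f f := by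
  ext i j
  simp [embMatrix, Matrix.mul_apply, Matrix.one_apply, Finset.sum_ite_eq]

theorem conjTranspose_embMatrix_mul_self {σ ν : Type*} [Fintype σ] [DecidableEq σ]
    [DecidableEq ν] {f : ν → σ} (hf : Function.Injective f) :
    (embMatrix f)ᴴ * embMatrix f = 1 := by
  have := conjTranspose_embMatrix_mul_mul f 1
  rw [Matrix.mul_one] at this
  rw [this, Matrix.submatrix_one _ hf]

theorem embMatrix_eq_stack {σ ι ν : Type*} [DecidableEq σ] [DecidableEq ι] (f : ν → σ) (e : ι) :
    embMatrix (fun i => (f i, e)) = stack (Pi.single e (embMatrix f)) := by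
  ext ⟨s, e'⟩ j
  by_cases h : e' = e
  · subst h
    simp [embMatrix, stack, Matrix.one_apply]
  · simp [embMatrix, stack, h]

theorem conjTranspose_stack_single_mul_stack {σ ι ν : Type*} [Fintype σ] [Fintype ι]
    [DecidableEq ι] (e : ι) (J : Matrix σ ν ℂ) (c : ι → Matrix σ ν ℂ) :
    (stack (Pi.single e J))ᴴ * stack c = Jᴴ * c e := by
  ext i j
  simp only [Matrix.mul_apply, Fintype.sum_prod_type, stack, Matrix.conjTranspose_apply]
  refine Finset.sum_congr rfl fun s _ => ?_
  rw [Finset.sum_eq_single e]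
  · simp
  · intro e' _ h
    simp [h]
  · simp

/-- The reflection `2 J J† - 1`. -/
noncomputable def reflectionMatrix {σ ν : Type*} [Fintype ν] [DecidableEq σ] (J : Matrix σ ν ℂ) :
    Matrix σ σ ℂ := (2 : ℂ) • (J * Jᴴ) - 1

theorem conjTranspose_reflectionMatrix {σ ν : Type*} [Fintype ν] [DecidableEq σ]
    (J : Matrix σ ν ℂ) : (reflectionMatrix J)ᴴ = reflectionMatrix J := by
  simp [reflectionMatrix, Matrix.conjTranspose_smul]

variable {σ ν : Type*} [Fintype σ] [Fintype ν] [DecidableEq σ] [DecidableEq ν]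

theorem reflectionMatrix_mul {J : Matrix σ ν ℂ} (hJ : Jᴴ * J = 1) : reflectionMatrix J * J = J := by
  rw [reflectionMatrix, Matrix.sub_mul, Matrix.smul_mul, Matrix.mul_assoc, hJ, Matrix.mul_one,
    Matrix.one_mul, two_smul, add_sub_cancel_right]

theorem conjTranspose_mul_reflectionMatrix {J : Matrix σ ν ℂ} (hJ : Jᴴ * J = 1) :
    Jᴴ * reflectionMatrix J = Jᴴ := by
  have := congrArg Matrix.conjTranspose (reflectionMatrix_mul hJ)
  rwa [Matrix.conjTranspose_mul, conjTranspose_reflectionMatrix] at this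

theorem reflectionMatrix_mul_self {J : Matrix σ ν ℂ} (hJ : Jᴴ * J = 1) :
    reflectionMatrix J * reflectionMatrix J = 1 := by
  have h : reflectionMatrix J * (J * Jᴴ) = J * Jᴴ := by
    rw [← Matrix.mul_assoc, reflectionMatrix_mul hJ]
  nth_rewrite 2 [reflectionMatrix]
  rw [mul_sub, mul_one, mul_smul_comm, h, reflectionMatrix, sub_sub_cancel]

theorem reflectionMatrix_mem_unitaryGroup {J : Matrix σ ν ℂ} (hJ : Jᴴ * J = 1) :
    reflectionMatrix J ∈ Matrix.unitaryGroup σ ℂ := by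
  rw [Matrix.mem_unitaryGroup_iff, Matrix.star_eq_conjTranspose, conjTranspose_reflectionMatrix,
    reflectionMatrix_mul_self hJ]

/-- One round of oblivious amplitude amplification acts on the encoded block as
`B ↦ 3 B - 4 B B† B`. -/
theorem amplitude_amplification {J : Matrix σ ν ℂ} (hJ : Jᴴ * J = 1) {V : Matrix σ σ ℂ}
    (hV : V ∈ Matrix.unitaryGroup σ ℂ) :
    Jᴴ * (-(V * (reflectionMatrix J * (star V * (reflectionMatrix J * V))))) * J =
      (3 : ℂ) • (Jᴴ * V * J) - (4 : ℂ) • ((Jᴴ * V * J) * (Jᴴ * V * J)ᴴ * (Jᴴ * V * J)) := by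
  have h1 : V * Vᴴ = 1 := Matrix.mem_unitaryGroup_iff.1 hV
  have h1' : Vᴴ * V = 1 := Matrix.mem_unitaryGroup_iff'.1 hV
  have e1 : V * (reflectionMatrix J * (star V * (reflectionMatrix J * V))) =
      (4 : ℂ) • (V * (J * Jᴴ) * Vᴴ * (J * Jᴴ) * V) - (2 : ℂ) • (V * (J * Jᴴ)) -
        (2 : ℂ) • ((J * Jᴴ) * V) + V := by
    have a1 : V * (J * Jᴴ) * Vᴴ * V = V * (J * Jᴴ) := by rw [mul_assoc _ Vᴴ, h1', mul_one]
    have a2 : V * Vᴴ * (J * Jᴴ) * V = (J * Jᴴ) * V := by rw [h1, one_mul]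
    have a3 : V * Vᴴ * V = V := by rw [h1, one_mul]
    simp only [reflectionMatrix, Matrix.star_eq_conjTranspose, mul_sub, sub_mul, one_mul,
      smul_mul_assoc, mul_smul_comm, ← mul_assoc, smul_sub, smul_smul]
    rw [a1, a2, a3]
    module
  have e2 : Jᴴ * (V * (J * Jᴴ) * Vᴴ * (J * Jᴴ) * V) * J =
      (Jᴴ * V * J) * (Jᴴ * V * J)ᴴ * (Jᴴ * V * J) := by
    simp only [Matrix.conjTranspose_mul, Matrix.conjTranspose_conjTranspose, Matrix.mul_assoc]
  have e3 : Jᴴ * (V * (J * Jᴴ)) * J = Jᴴ * V * J := by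
    simp only [Matrix.mul_assoc, hJ, Matrix.mul_one]
  have e4 : Jᴴ * ((J * Jᴴ) * V) * J = Jᴴ * V * J := by
    simp only [← Matrix.mul_assoc, hJ, Matrix.one_mul]
  rw [e1]
  simp only [Matrix.mul_neg, Matrix.neg_mul, Matrix.mul_add, Matrix.add_mul, Matrix.mul_sub,
    Matrix.sub_mul, Matrix.mul_smul, Matrix.smul_mul, e2, e3, e4]
  module

end Blocks

/-! ### Gates controlled by a projection -/

section ControlledGates

variable {σ ι : Type*} [Fintype σ] [Fintype ι] [DecidableEq σ] [DecidableEq ι]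

theorem kronecker_add_kronecker_mul {Q : Matrix ι ι ℂ} (hQ : Q * Q = Q) (A B A' B' : Matrix σ σ ℂ) :
    (A ⊗ₖ Q + B ⊗ₖ (1 - Q)) * (A' ⊗ₖ Q + B' ⊗ₖ (1 - Q)) =
      (A * A') ⊗ₖ Q + (B * B') ⊗ₖ (1 - Q) := by
  have h1 : Q * (1 - Q) = 0 := by rw [mul_sub, mul_one, hQ, sub_self]
  have h2 : (1 - Q) * Q = 0 := by rw [sub_mul, one_mul, hQ, sub_self]
  have h3 : (1 - Q) * (1 - Q) = 1 - Q := by rw [mul_sub, mul_one, h2, sub_zero]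
  simp only [mul_add, add_mul, ← Matrix.mul_kronecker_mul, hQ, h1, h2, h3,
    Matrix.kronecker_zero, add_zero, zero_add]

theorem kronecker_add_kronecker_self {σ ι : Type*} [DecidableEq ι] (Q : Matrix ι ι ℂ) (A : Matrix σ σ ℂ) :
    A ⊗ₖ Q + A ⊗ₖ (1 - Q) = A ⊗ₖ 1 := by
  rw [← Matrix.kronecker_add, add_sub_cancel]

theorem kronecker_add_kronecker_mem_unitaryGroup {Q : Matrix ι ι ℂ} (hQ : Q * Q = Q)
    (hQs : Qᴴ = Q) {A B : Matrix σ σ ℂ} (hA : A ∈ Matrix.unitaryGroup σ ℂ)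
    (hB : B ∈ Matrix.unitaryGroup σ ℂ) :
    A ⊗ₖ Q + B ⊗ₖ (1 - Q) ∈ Matrix.unitaryGroup (σ × ι) ℂ := by
  have hA' : A * Aᴴ = 1 := Matrix.mem_unitaryGroup_iff.1 hA
  have hB' : B * Bᴴ = 1 := Matrix.mem_unitaryGroup_iff.1 hB
  rw [Matrix.mem_unitaryGroup_iff, Matrix.star_eq_conjTranspose, Matrix.conjTranspose_add,
    Matrix.conjTranspose_kronecker, Matrix.conjTranspose_kronecker, Matrix.conjTranspose_sub,
    Matrix.conjTranspose_one, hQs, kronecker_add_kronecker_mul hQ, hA', hB',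
    kronecker_add_kronecker_self, Matrix.one_kronecker_one]

theorem one_kronecker_mem_unitaryGroup {R : Matrix ι ι ℂ} (hR : R ∈ Matrix.unitaryGroup ι ℂ) :
    (1 : Matrix σ σ ℂ) ⊗ₖ R ∈ Matrix.unitaryGroup (σ × ι) ℂ := by
  have hR' : R * Rᴴ = 1 := Matrix.mem_unitaryGroup_iff.1 hR
  rw [Matrix.mem_unitaryGroup_iff, Matrix.star_eq_conjTranspose, Matrix.conjTranspose_kronecker,
    Matrix.conjTranspose_one, ← Matrix.mul_kronecker_mul, hR', one_mul, Matrix.one_kronecker_one]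

/-- A unit vector is a column of a unitary matrix. -/
theorem exists_unitary_col_eq (i₀ : ι) {c : ι → ℂ}
    (hc : ∑ i, c i * (starRingEnd ℂ) (c i) = 1) :
    ∃ R ∈ Matrix.unitaryGroup ι ℂ, ∀ i, R i i₀ = c i := by
  have hnorm : ‖(WithLp.toLp 2 c : EuclideanSpace ℂ ι)‖ = 1 := by
    rw [EuclideanSpace.norm_eq, Real.sqrt_eq_one]
    have : ((∑ i, ‖c i‖ ^ 2 : ℝ) : ℂ) = 1 := by
      rw [← hc, Complex.ofReal_sum]
      refine Finset.sum_congr rfl fun i _ => ?_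
      rw [Complex.mul_conj, Complex.normSq_eq_norm_sq]
    exact_mod_cast this
  have horth : Orthonormal ℂ (({i₀} : Set ι).domRestrict
      fun _ => (WithLp.toLp 2 c : EuclideanSpace ℂ ι)) := by
    constructor
    · exact fun _ => hnorm
    · intro x y hxy
      exact absurd (Subsingleton.elim x y) hxy
  obtain ⟨b, hb⟩ := horth.exists_orthonormalBasis_extension_of_card_eq (by simp)
  refine ⟨Matrix.of fun i j => (b j : EuclideanSpace ℂ ι) i, ?_, fun i => ?_⟩
  · rw [Matrix.mem_unitaryGroup_iff']
    ext i j
    have := orthonormal_iff_ite.1 b.orthonormal i j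
    rw [Matrix.one_apply, ← this]
    simp [Matrix.mul_apply, PiLp.inner_apply, mul_comm, Matrix.star_apply]
  · simp only [Matrix.of_apply, hb i₀ rfl]

end ControlledGates

/-! ### The walk operator and its half steps -/

section Walk

variable {σ ν : Type*} [Fintype σ] [Fintype ν] [DecidableEq σ] [DecidableEq ν]

/-- The walk operator `Z U† Z U`, where `Z` is the reflection about the range of `J`. -/
noncomputable def walk (J : Matrix σ ν ℂ) (U : Matrix σ σ ℂ) : Matrix σ σ ℂ :=
  reflectionMatrix J * Uᴴ * reflectionMatrix J * U

/-- The `D`-th alternating query that advances the walk by half a step. -/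
noncomputable def queryFwd (J : Matrix σ ν ℂ) (U : Matrix σ σ ℂ) (D : ℕ) : Matrix σ σ ℂ :=
  if Even D then reflectionMatrix J * U else reflectionMatrix J * Uᴴ

/-- The `D`-th alternating query that moves the walk back by half a step. -/
noncomputable def queryBwd (J : Matrix σ ν ℂ) (U : Matrix σ σ ℂ) (D : ℕ) : Matrix σ σ ℂ :=
  if Even D then U * reflectionMatrix J else Uᴴ * reflectionMatrix J

/-- The product of the first `D` backward queries. -/
noncomputable def bwdProd (J : Matrix σ ν ℂ) (U : Matrix σ σ ℂ) (D : ℕ) : Matrix σ σ ℂ :=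
  if Even D then (walk J U)ᴴ ^ (D / 2) else U * reflectionMatrix J * (walk J U)ᴴ ^ (D / 2)

variable {J : Matrix σ ν ℂ} {U : Matrix σ σ ℂ}

theorem conjTranspose_walk {σ ν : Type*} [Fintype σ] [Fintype ν] [DecidableEq σ]
    {J : Matrix σ ν ℂ} {U : Matrix σ σ ℂ} : (walk J U)ᴴ = Uᴴ * reflectionMatrix J * U * reflectionMatrix J := by
  simp [walk, conjTranspose_reflectionMatrix, Matrix.mul_assoc]

theorem mul_reflection_mul_reflection (hJ : Jᴴ * J = 1) (A : Matrix σ σ ℂ) :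
    A * reflectionMatrix J * reflectionMatrix J = A := by
  rw [mul_assoc, reflectionMatrix_mul_self hJ, mul_one]

theorem walk_mem_unitaryGroup (hJ : Jᴴ * J = 1) (hU : U ∈ Matrix.unitaryGroup σ ℂ) :
    walk J U ∈ Matrix.unitaryGroup σ ℂ :=
  mul_mem (mul_mem (mul_mem (reflectionMatrix_mem_unitaryGroup hJ) (Unitary.star_mem hU))
    (reflectionMatrix_mem_unitaryGroup hJ)) hU

theorem conjTranspose_walk_mul_walk (hJ : Jᴴ * J = 1) (hU : U ∈ Matrix.unitaryGroup σ ℂ) :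
    (walk J U)ᴴ * walk J U = 1 := Matrix.mem_unitaryGroup_iff'.1 (walk_mem_unitaryGroup hJ hU)

theorem walk_mul_conjTranspose_walk (hJ : Jᴴ * J = 1) (hU : U ∈ Matrix.unitaryGroup σ ℂ) :
    walk J U * (walk J U)ᴴ = 1 := Matrix.mem_unitaryGroup_iff.1 (walk_mem_unitaryGroup hJ hU)

theorem commute_walk (hJ : Jᴴ * J = 1) (hU : U ∈ Matrix.unitaryGroup σ ℂ) :
    Commute (walk J U)ᴴ (walk J U) := by
  rw [Commute, SemiconjBy, conjTranspose_walk_mul_walk hJ hU, walk_mul_conjTranspose_walk hJ hU]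

theorem reflection_mul_oracle (hJ : Jᴴ * J = 1) (hU : U ∈ Matrix.unitaryGroup σ ℂ) :
    U * reflectionMatrix J * walk J U = reflectionMatrix J * U := by
  have h1 : U * Uᴴ = 1 := Matrix.mem_unitaryGroup_iff.1 hU
  simp only [walk, ← mul_assoc]
  rw [mul_reflection_mul_reflection hJ, h1, one_mul]

theorem queryBwd_mul_bwdProd {σ ν : Type*} [Fintype σ] [Fintype ν] [DecidableEq σ]
    {J : Matrix σ ν ℂ} {U : Matrix σ σ ℂ} (D : ℕ) :
    queryBwd J U D * bwdProd J U D = bwdProd J U (D + 1) := by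
  rcases Nat.even_or_odd' D with ⟨k, rfl | rfl⟩
  · have h1 : ¬ Even (2 * k + 1) := by grind
    have h2 : (2 * k + 1) / 2 = k := by omega
    have h3 : 2 * k / 2 = k := by omega
    rw [queryBwd, bwdProd, bwdProd, if_pos (even_two_mul k), if_pos (even_two_mul k), if_neg h1,
      h2, h3]
  · have h1 : ¬ Even (2 * k + 1) := by grind
    have h4 : Even (2 * k + 1 + 1) := by grind
    have h2 : (2 * k + 1) / 2 = k := by omega
    have h3 : (2 * k + 1 + 1) / 2 = k + 1 := by omega
    rw [queryBwd, bwdProd, bwdProd, if_neg h1, if_neg h1, if_pos h4, h2, h3, pow_succ',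
      conjTranspose_walk]
    simp only [mul_assoc]

/-- Compared with `queryBwd_mul_bwdProd`, the forward query yields one extra factor `walk J U` on
the right. This is `U Z W = Z U` in the even case and `W† W = 1` in the odd case. -/
theorem queryFwd_mul_bwdProd (hJ : Jᴴ * J = 1) (hU : U ∈ Matrix.unitaryGroup σ ℂ) (D : ℕ) :
    queryFwd J U D * bwdProd J U D = bwdProd J U (D + 1) * walk J U := by
  have hc := commute_walk hJ hU
  rcases Nat.even_or_odd' D with ⟨k, rfl | rfl⟩
  · have h1 : ¬ Even (2 * k + 1) := by grind
    have h2 : (2 * k + 1) / 2 = k := by omega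
    have h3 : 2 * k / 2 = k := by omega
    rw [queryFwd, bwdProd, bwdProd, if_pos (even_two_mul k), if_pos (even_two_mul k), if_neg h1,
      h2, h3, mul_assoc (U * _), (hc.pow_left k).eq, ← mul_assoc, reflection_mul_oracle hJ hU]
  · have h1 : ¬ Even (2 * k + 1) := by grind
    have h4 : Even (2 * k + 1 + 1) := by grind
    have h2 : (2 * k + 1) / 2 = k := by omega
    have h3 : (2 * k + 1 + 1) / 2 = k + 1 := by omega
    have h5 : Uᴴ * U = 1 := Matrix.mem_unitaryGroup_iff'.1 hU
    rw [queryFwd, bwdProd, bwdProd, if_neg h1, if_neg h1, if_pos h4, h2, h3, pow_succ,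
      mul_assoc (_ ^ k), conjTranspose_walk_mul_walk hJ hU, mul_one, mul_assoc U, mul_assoc _ Uᴴ, ← mul_assoc Uᴴ, h5,
      one_mul, ← mul_assoc, reflectionMatrix_mul_self hJ, one_mul]

variable {ι : Type*} [Fintype ι] [DecidableEq ι]

theorem sum_smul_mul_mul {σ ν ι : Type*} [Fintype σ] [Fintype ι] {J : Matrix σ ν ℂ} (a : ι → ℂ) (A : Matrix σ σ ℂ) (g : ι → Matrix σ σ ℂ) :
    ∑ j, a j • (A * (g j * J)) = A * (∑ j, a j • g j) * J := by
  simp only [Matrix.mul_sum, Matrix.sum_mul, Matrix.mul_smul, Matrix.smul_mul, Matrix.mul_assoc]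

open Polynomial in
-- The range of `u u†` gets the forward query and its complement the backward one. After the common
-- factor `bwdProd J U (D + 1)` is taken out, what remains is `1 + (W - 1) u u†`.
theorem query_mul_stack (hJ : Jᴴ * J = 1) (hU : U ∈ Matrix.unitaryGroup σ ℂ) (D : ℕ)
    (u : ι → ℂ) (p : ι → ℂ[X]) :
    (queryFwd J U D ⊗ₖ Matrix.vecMulVec u (star u) +
      queryBwd J U D ⊗ₖ (1 - Matrix.vecMulVec u (star u))) *
        stack (fun i => bwdProd J U D * aeval (walk J U) (p i) * J) =
      stack fun i => bwdProd J U (D + 1) * aeval (walk J U) (vecStep u p i) * J := by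
  rw [Matrix.add_mul, kronecker_mul_stack, kronecker_mul_stack, stack_add]
  congr 1
  funext i
  have e1 : ∀ j, queryFwd J U D * (bwdProd J U D * aeval (walk J U) (p j) * J) =
      bwdProd J U (D + 1) * walk J U * (aeval (walk J U) (p j) * J) := fun j => by
    rw [← queryFwd_mul_bwdProd hJ hU D]
    simp only [Matrix.mul_assoc]
  have e2 : ∀ j, queryBwd J U D * (bwdProd J U D * aeval (walk J U) (p j) * J) =
      bwdProd J U (D + 1) * (aeval (walk J U) (p j) * J) := fun j => by
    rw [← queryBwd_mul_bwdProd D]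
    simp only [Matrix.mul_assoc]
  simp only [Pi.add_apply, e1, e2, sum_smul_mul_mul]
  have e3 : ∑ j, Matrix.vecMulVec u (star u) i j • aeval (walk J U) (p j) =
      u i • ∑ j, (starRingEnd ℂ) (u j) • aeval (walk J U) (p j) := by
    rw [Finset.smul_sum]
    refine Finset.sum_congr rfl fun j _ => ?_
    rw [smul_smul]
    rfl
  have e4 : ∑ j, (1 - Matrix.vecMulVec u (star u)) i j • aeval (walk J U) (p j) =
      aeval (walk J U) (p i) - u i • ∑ j, (starRingEnd ℂ) (u j) • aeval (walk J U) (p j) := by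
    simp only [Matrix.sub_apply, sub_smul, Finset.sum_sub_distrib, e3, Matrix.one_apply, ite_smul,
      one_smul, zero_smul, Finset.sum_ite_eq, Finset.mem_univ, if_true]
  have e5 : aeval (walk J U) (vecStep u p i) = aeval (walk J U) (p i) + (walk J U - 1) *
      (u i • ∑ j, (starRingEnd ℂ) (u j) • aeval (walk J U) (p j)) := by
    simp only [vecStep, map_add, map_mul, map_sub, map_sum, aeval_X, map_one, ← smul_eq_C_mul,
      map_smul]
  rw [e3, e4, e5, ← Matrix.add_mul]
  congr 1
  simp only [mul_add, sub_mul, mul_sub, one_mul, mul_smul_comm, mul_assoc]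
  module

end Walk

/-! ### Signal processing with one call per degree -/

section Signal

variable {m k n : ℕ}

theorem vecMulVec_star_mul_self {ι : Type*} [Fintype ι] {u : ι → ℂ}
    (hu : ∑ i, (starRingEnd ℂ) (u i) * u i = 1) :
    Matrix.vecMulVec u (star u) * Matrix.vecMulVec u (star u) = Matrix.vecMulVec u (star u) := by
  rw [Matrix.vecMulVec_mul_vecMulVec]
  have : star u ⬝ᵥ u = 1 := hu
  simp [this]

/-- The isometry adding `m` qubits in state zero. -/
noncomputable def ancilla (m n : ℕ) : Matrix (Qubits m × Qubits n) (Qubits n) ℂ :=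
  embMatrix fun i => (0, i)

theorem conjTranspose_ancilla_mul_self :
    (ancilla m n)ᴴ * ancilla m n = 1 :=
  conjTranspose_embMatrix_mul_self fun _ _ h => (Prod.mk.inj h).2

/-- The two queries differ only in the side on which the reflection stands. Hence the oracle call
itself needs no control: `Z` controlled on `u u†` follows it, and `Z` controlled on the complement
precedes it. -/
theorem implementable_query {u : Qubits k → ℂ} (hu : ∑ i, (starRingEnd ℂ) (u i) * u i = 1)
    (D : ℕ) :
    Implementable 1 fun U : Matrix (Qubits m × Qubits n) (Qubits m × Qubits n) ℂ =>
      queryFwd (ancilla m n) U D ⊗ₖ Matrix.vecMulVec u (star u) +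
        queryBwd (ancilla m n) U D ⊗ₖ (1 - Matrix.vecMulVec u (star u)) := by
  have hQ := vecMulVec_star_mul_self hu
  have hQs : (Matrix.vecMulVec u (star u))ᴴ = Matrix.vecMulVec u (star u) := by
    rw [Matrix.conjTranspose_vecMulVec, star_star]
  have hZ := reflectionMatrix_mem_unitaryGroup (conjTranspose_ancilla_mul_self (m := m) (n := n))
  have h1 := implementable_fixed (kronecker_add_kronecker_mem_unitaryGroup hQ hQs hZ (one_mem _))
  have h2 := implementable_fixed (kronecker_add_kronecker_mem_unitaryGroup hQ hQs (one_mem _) hZ)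
  by_cases hD : Even D
  · refine ((h1.mul implementable_call).mul h2).congr fun U _ => ?_
    rw [← kronecker_add_kronecker_self (Matrix.vecMulVec u (star u)),
      kronecker_add_kronecker_mul hQ, kronecker_add_kronecker_mul hQ]
    simp only [queryFwd, queryBwd, if_pos hD, mul_one, one_mul]
  · refine ((h1.mul implementable_callAdj).mul h2).congr fun U _ => ?_
    rw [← kronecker_add_kronecker_self (Matrix.vecMulVec u (star u)),
      kronecker_add_kronecker_mul hQ, kronecker_add_kronecker_mul hQ]
    simp only [queryFwd, queryBwd, if_neg hD, mul_one, one_mul]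
    rfl

open Polynomial in
/-- Signal processing: a vector of polynomials of degree at most `D` with unit norm on the circle
is realized as the first block column of a circuit with `D` calls. -/
theorem exists_implementable_stack {i₀ : Qubits k} (D : ℕ) : ∀ p : Qubits k → ℂ[X], p i₀ = 0 →
    (∀ i, (p i).natDegree ≤ D) →
    (∀ z : ℂ, ‖z‖ = 1 → ∑ i, (p i).eval z * (starRingEnd ℂ) ((p i).eval z) = 1) →
    ∃ F : OracleOperator m k n, Implementable D F ∧
      ∀ U ∈ Matrix.unitaryGroup (Qubits m × Qubits n) ℂ,
        F U * stack (Pi.single (0 : Qubits k) (ancilla m n)) =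
          stack fun i => bwdProd (ancilla m n) U D * aeval (walk (ancilla m n) U) (p i) *
            ancilla m n := by
  induction D with
  | zero =>
    intro p _ hdeg hnorm
    have hp : ∀ i, p i = C ((p i).coeff 0) := fun i => eq_C_of_natDegree_le_zero (hdeg i)
    have hc : ∑ i, (p i).coeff 0 * (starRingEnd ℂ) ((p i).coeff 0) = 1 := by
      rw [← hnorm 1 (by simp)]
      refine Finset.sum_congr rfl fun i _ => ?_
      conv_rhs => rw [hp i, eval_C]
    obtain ⟨R, hR, hRc⟩ := exists_unitary_col_eq (0 : Qubits k) hc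
    refine ⟨_, implementable_fixed (one_kronecker_mem_unitaryGroup hR), fun U _ => ?_⟩
    rw [kronecker_mul_stack]
    congr 1
    funext i
    rw [Finset.sum_eq_single 0]
    · rw [hp i, hRc]
      simp [bwdProd, Algebra.algebraMap_eq_smul_one]
    · intro j _ hj
      simp [hj]
    · simp
  | succ D ih =>
    intro p hi₀ hdeg hnorm
    obtain ⟨u, p', hu, hpu, hi₀', hdeg', hnorm'⟩ := exists_vecStep_eq hi₀ hdeg hnorm
    obtain ⟨F, hF, h⟩ := ih p' hi₀' hdeg' hnorm'
    refine ⟨_, add_comm 1 D ▸ (implementable_query hu D).mul hF, fun U hU => ?_⟩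
    rw [Matrix.mul_assoc, h U hU, query_mul_stack conjTranspose_ancilla_mul_self hU, ← hpu]

end Signal

open Polynomial

/-! ### From parity parts to polynomials on the circle -/

section Homogenization

/-- The polynomial `X ^ (N - 1) r ((2 + X + X⁻¹) / 4)`, for `r` of degree less than `N`. -/
noncomputable def homogenizeCosSq (N : ℕ) (r : ℂ[X]) : ℂ[X] :=
  ∑ j ∈ Finset.range N, C (r.coeff j) * (X ^ (N - 1 - j) * (C (1 / 4) * (X + 1) ^ 2) ^ j)

theorem natDegree_homogenizeCosSq_le (N : ℕ) (r : ℂ[X]) :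
    (homogenizeCosSq N r).natDegree ≤ 2 * (N - 1) := by
  refine natDegree_sum_le_of_forall_le _ _ fun j hj => ?_
  have hj := Finset.mem_range.1 hj
  refine (natDegree_C_mul_le _ _).trans (natDegree_mul_le.trans ?_)
  have h1 : (X + 1 : ℂ[X]).natDegree ≤ 1 := by
    rw [← C_1]; exact (natDegree_X_add_C _).le
  have h2 : (C (1 / 4) * (X + 1) ^ 2 : ℂ[X]).natDegree ≤ 2 :=
    (natDegree_C_mul_le _ _).trans (natDegree_pow_le_of_le 2 h1)
  have h3 := natDegree_pow_le_of_le j h2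
  have h4 : (X ^ (N - 1 - j) : ℂ[X]).natDegree ≤ N - 1 - j := natDegree_X_pow_le _
  omega

/-- `(2 + w + w') / 4`, the square of the cosine when `w, w' = exp (± 2 i θ)`. -/
noncomputable def cosSq {A : Type*} [Ring A] [Algebra ℂ A] (w w' : A) : A :=
  (1 / 4 : ℂ) • (2 + w + w')

theorem mul_aeval_homogenizeCosSq {A : Type*} [Ring A] [Algebra ℂ A] {w w' : A} (h : w * w' = 1)
    (h' : w' * w = 1) {N : ℕ} {r : ℂ[X]} (hr : r.degree < N) :
    w * aeval w (homogenizeCosSq N r) = w ^ N * aeval (cosSq w w') r := by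
  have hsum : aeval (cosSq w w') r = ∑ j ∈ Finset.range N, r.coeff j • cosSq w w' ^ j := by
    rcases Nat.eq_zero_or_pos N with rfl | hN
    · have : r = 0 := degree_lt_iff_coeff_zero _ _ |>.1 hr |> fun h => by ext j; simpa using h j
      simp [this]
    · refine aeval_eq_sum_range' ?_ _
      rcases eq_or_ne r 0 with rfl | h0
      · simpa using hN
      · exact (natDegree_lt_iff_degree_lt h0).2 hr
  have hcomm : Commute w (cosSq w w') := by
    refine Commute.smul_right ?_ _
    refine Commute.add_right (Commute.add_right (Commute.ofNat_right w 2) (Commute.refl w)) ?_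
    rw [Commute, SemiconjBy, h, h']
  have hsq : (1 / 4 : ℂ) • (w + 1) ^ 2 = w * cosSq w w' := by
    rw [cosSq, mul_smul_comm, mul_add, mul_add, h]
    congr 1
    noncomm_ring
  rw [hsum, homogenizeCosSq, map_sum, Finset.mul_sum, Finset.mul_sum]
  refine Finset.sum_congr rfl fun j hj => ?_
  have hj := Finset.mem_range.1 hj
  simp only [map_mul, map_pow, map_add, aeval_X, aeval_C, map_one, ← Algebra.smul_def]
  rw [hsq, hcomm.mul_pow, mul_smul_comm, mul_smul_comm, ← mul_assoc, ← mul_assoc, ← pow_succ',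
    ← pow_add, show N - 1 - j + 1 + j = N by omega]

/-- Thus `contract 2 p` and `contract 2 p.divX` encode the even and odd parts of `p` as polynomials
in the square of the variable. -/
theorem eq_expand_contract_add (p : ℂ[X]) :
    p = expand ℂ 2 (contract 2 p) + X * expand ℂ 2 (contract 2 p.divX) := by
  ext n
  rw [coeff_add]
  rcases n with _ | n
  · simp [coeff_expand, coeff_contract]
  · rw [coeff_X_mul, coeff_expand two_pos, coeff_expand two_pos, coeff_contract two_ne_zero,
      coeff_contract two_ne_zero, coeff_divX]
    rcases Nat.even_or_odd' n with ⟨k, rfl | rfl⟩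
    · have h1 : ¬ 2 ∣ 2 * k + 1 := by omega
      rw [if_neg h1, if_pos (dvd_mul_right 2 k), zero_add, Nat.div_mul_cancel (dvd_mul_right 2 k)]
    · have h1 : ¬ 2 ∣ 2 * k + 1 := by omega
      have h2 : 2 ∣ 2 * k + 1 + 1 := by omega
      rw [if_neg h1, if_pos h2, add_zero, Nat.div_mul_cancel h2]

theorem aeval_eq_contract {A : Type*} [Ring A] [Algebra ℂ A] (a : A) (p : ℂ[X]) :
    aeval a p = aeval (a ^ 2) (contract 2 p) + a * aeval (a ^ 2) (contract 2 p.divX) := by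
  conv_lhs => rw [eq_expand_contract_add p, map_add, map_mul, aeval_X, expand_aeval, expand_aeval]

theorem degree_contract_two_lt {p : ℂ[X]} {D N : ℕ} (hp : p.degree < D) (h : D ≤ 2 * N) :
    (contract 2 p).degree < N := by
  rw [degree_lt_iff_coeff_zero] at hp ⊢
  intro j hj
  rw [coeff_contract two_ne_zero]
  exact hp _ (by omega)

theorem degree_contract_two_divX_lt {p : ℂ[X]} {D N : ℕ} (hp : p.degree < D)
    (h : D ≤ 2 * N + 1) : (contract 2 p.divX).degree < N := by
  rw [degree_lt_iff_coeff_zero] at hp ⊢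
  intro j hj
  rw [coeff_contract two_ne_zero, coeff_divX]
  exact hp _ (by omega)

theorem norm_eval_homogenizeCosSq {z : ℂ} (hz : ‖z‖ = 1) {N : ℕ} {r : ℂ[X]} (hr : r.degree < N) :
    ‖(homogenizeCosSq N r).eval z‖ = ‖r.eval (((1 + z.re) / 2 : ℝ) : ℂ)‖ := by
  have h1 := mul_conj_of_norm_eq_one hz
  have h2 := mul_aeval_homogenizeCosSq h1 ((mul_comm _ _).trans h1) hr
  have h3 : cosSq z ((starRingEnd ℂ) z) = (((1 + z.re) / 2 : ℝ) : ℂ) := by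
    rw [cosSq, smul_eq_mul, add_assoc, Complex.add_conj]
    push_cast
    ring
  rw [h3] at h2
  have h4 := congrArg norm h2
  rw [norm_mul, norm_mul, norm_pow, hz, one_mul, one_pow, one_mul] at h4
  simpa using h4

theorem norm_half_one_add_sq {z : ℂ} (hz : ‖z‖ = 1) : ‖(1 + z) / 2‖ ^ 2 = (1 + z.re) / 2 := by
  have h1 : z.re * z.re + z.im * z.im = 1 := by
    rw [← Complex.normSq_apply, Complex.normSq_eq_norm_sq, hz, one_pow]
  rw [← Complex.normSq_eq_norm_sq, map_div₀, Complex.normSq_apply]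
  simp
  linarith

/-- With `e` and `o` the two parts at `s`, `p (±√s) = e ± √s o`; the parallelogram law averages the
two bounds. Since the bound is joint, adding both parities costs nothing more. -/
theorem contract_parallelogram {p : ℂ[X]} {b : ℝ} (hb : ∀ x : ℝ, |x| ≤ 1 → ‖p.eval (x : ℂ)‖ ^ 2 < b)
    {s : ℝ} (h0 : 0 ≤ s) (h1 : s ≤ 1) :
    ‖(contract 2 p).eval (s : ℂ)‖ ^ 2 + s * ‖(contract 2 p.divX).eval (s : ℂ)‖ ^ 2 < b := by
  have hx0 := Real.sqrt_nonneg s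
  have hx1 : √s ≤ 1 := Real.sqrt_le_one.2 h1
  have hxs : √s ^ 2 = s := Real.sq_sqrt h0
  have e1 := aeval_eq_contract ((√s : ℝ) : ℂ) p
  have e2 := aeval_eq_contract ((-√s : ℝ) : ℂ) p
  rw [← Complex.ofReal_pow, hxs] at e1
  rw [← Complex.ofReal_pow, neg_sq, hxs] at e2
  simp only [coe_aeval_eq_eval] at e1 e2
  have b1 := hb (√s) (abs_le.2 ⟨by linarith, hx1⟩)
  have b2 := hb (-√s) (abs_le.2 ⟨by linarith, by linarith⟩)
  rw [e1] at b1
  rw [e2, Complex.ofReal_neg, neg_mul, ← sub_eq_add_neg] at b2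
  have := parallelogram_law_with_norm ℝ ((contract 2 p).eval (s : ℂ))
    ((√s : ℂ) * (contract 2 p.divX).eval (s : ℂ))
  rw [norm_mul, Complex.norm_real, Real.norm_eq_abs, abs_of_nonneg hx0] at this
  nlinarith [this]

end Homogenization

/-! ### Polynomials of the encoded block -/

section WalkBlocks

variable {σ ν : Type*} [Fintype σ] [Fintype ν] [DecidableEq σ] [DecidableEq ν]
  {J : Matrix σ ν ℂ} {U : Matrix σ σ ℂ}

/-- Both `W J` and `W† J` are expressed through `J`, `J K²` and `U† J K`, where `K` is the block;
the terms with `U† J K` cancel in the sum. Hermiticity enters through `J† U† J = K`. -/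
theorem cosSq_walk_mul (hJ : Jᴴ * J = 1) (hU : U ∈ Matrix.unitaryGroup σ ℂ)
    (hH : (Jᴴ * U * J).IsHermitian) :
    cosSq (walk J U) (walk J U)ᴴ * J = J * (Jᴴ * U * J) ^ 2 := by
  have h5 : Uᴴ * U = 1 := Matrix.mem_unitaryGroup_iff'.1 hU
  have hH' : Jᴴ * Uᴴ * J = Jᴴ * U * J := by
    have := hH.eq
    simpa only [Matrix.conjTranspose_mul, Matrix.conjTranspose_conjTranspose, Matrix.mul_assoc]
      using this
  have e0 : Uᴴ * reflectionMatrix J * U = (2 : ℂ) • (Uᴴ * J * (Jᴴ * U)) - 1 := by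
    rw [reflectionMatrix, mul_sub, sub_mul, mul_one, h5, mul_smul_comm, smul_mul_assoc]
    simp only [Matrix.mul_assoc]
  have e1 : (walk J U)ᴴ * J = (2 : ℂ) • (Uᴴ * J * (Jᴴ * U * J)) - J := by
    rw [conjTranspose_walk, Matrix.mul_assoc, reflectionMatrix_mul hJ, e0, Matrix.sub_mul,
      Matrix.one_mul, Matrix.smul_mul]
    simp only [Matrix.mul_assoc]
  have e2 : walk J U * J = reflectionMatrix J * ((walk J U)ᴴ * J) := by
    rw [conjTranspose_walk, Matrix.mul_assoc _ (reflectionMatrix J) J, reflectionMatrix_mul hJ,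
      walk]
    simp only [Matrix.mul_assoc]
  have e3 : J * Jᴴ * (Uᴴ * J * (Jᴴ * U * J)) = J * (Jᴴ * U * J) ^ 2 := by
    rw [sq]
    nth_rewrite 2 [← hH']
    simp only [Matrix.mul_assoc]
  have e4 : reflectionMatrix J * (Uᴴ * J * (Jᴴ * U * J)) =
      (2 : ℂ) • (J * (Jᴴ * U * J) ^ 2) - Uᴴ * J * (Jᴴ * U * J) := by
    rw [reflectionMatrix, Matrix.sub_mul, Matrix.smul_mul, e3, Matrix.one_mul]
  have e5 : walk J U * J = (4 : ℂ) • (J * (Jᴴ * U * J) ^ 2) -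
      (2 : ℂ) • (Uᴴ * J * (Jᴴ * U * J)) - J := by
    rw [e2, e1, Matrix.mul_sub, Matrix.mul_smul, e4, reflectionMatrix_mul hJ]
    module
  have e6 : (2 : Matrix σ σ ℂ) * J = (2 : ℂ) • J := by
    rw [show (2 : Matrix σ σ ℂ) = 1 + 1 by norm_num, Matrix.add_mul, Matrix.one_mul, two_smul]
  rw [cosSq, Matrix.smul_mul, Matrix.add_mul, Matrix.add_mul, e5, e1, e6]
  module

theorem aeval_mul_of_mul_eq {Y : Matrix σ σ ℂ} {K : Matrix ν ν ℂ} (h : Y * J = J * K) (r : ℂ[X]) :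
    aeval Y r * J = J * aeval K r := by
  have hpow : ∀ j : ℕ, Y ^ j * J = J * K ^ j := by
    intro j
    induction j with
    | zero => simp
    | succ j ih => rw [pow_succ, Matrix.mul_assoc, h, ← Matrix.mul_assoc, ih, pow_succ,
        Matrix.mul_assoc]
  simp only [aeval_eq_sum_range, Matrix.sum_mul, Matrix.mul_sum, Matrix.smul_mul, Matrix.mul_smul,
    hpow]

theorem reflection_mul_oracle_mul_conjTranspose_walk (hJ : Jᴴ * J = 1)
    (hU : U ∈ Matrix.unitaryGroup σ ℂ) :
    reflectionMatrix J * U * (walk J U)ᴴ = U * reflectionMatrix J := by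
  rw [← reflection_mul_oracle hJ hU, mul_assoc, walk_mul_conjTranspose_walk hJ hU, mul_one]

/-- The block of the sum of an even and an odd polynomial in the walk. -/
theorem block_even_add_odd (hJ : Jᴴ * J = 1) (hU : U ∈ Matrix.unitaryGroup σ ℂ)
    (hH : (Jᴴ * U * J).IsHermitian) (p : ℂ[X]) :
    Jᴴ * (aeval (cosSq (walk J U) (walk J U)ᴴ) (contract 2 p) + reflectionMatrix J * U *
      ((1 / 2 : ℂ) • (1 + (walk J U)ᴴ)) *
        aeval (cosSq (walk J U) (walk J U)ᴴ) (contract 2 p.divX)) * J =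
      aeval (Jᴴ * U * J) p := by
  have h := cosSq_walk_mul hJ hU hH
  have e1 : reflectionMatrix J * U * ((1 / 2 : ℂ) • (1 + (walk J U)ᴴ)) =
      (1 / 2 : ℂ) • (reflectionMatrix J * U + U * reflectionMatrix J) := by
    rw [mul_smul_comm, mul_add, mul_one, reflection_mul_oracle_mul_conjTranspose_walk hJ hU]
  have e2 : Jᴴ * ((1 / 2 : ℂ) • (reflectionMatrix J * U + U * reflectionMatrix J)) * J =
      Jᴴ * U * J := by
    rw [Matrix.mul_smul, Matrix.smul_mul, Matrix.mul_add, Matrix.add_mul, ← Matrix.mul_assoc,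
      conjTranspose_mul_reflectionMatrix hJ, Matrix.mul_assoc Jᴴ (U * _), Matrix.mul_assoc U,
      reflectionMatrix_mul hJ, ← Matrix.mul_assoc]
    module
  rw [e1]
  generalize (1 / 2 : ℂ) • (reflectionMatrix J * U + U * reflectionMatrix J) = W at e2
  generalize Jᴴ * U * J = K at h e2
  rw [Matrix.mul_assoc Jᴴ, Matrix.add_mul, aeval_mul_of_mul_eq h, Matrix.mul_assoc W _ J,
    aeval_mul_of_mul_eq h, Matrix.mul_add, ← Matrix.mul_assoc Jᴴ, hJ, Matrix.one_mul,
    ← Matrix.mul_assoc W, ← Matrix.mul_assoc Jᴴ, ← Matrix.mul_assoc Jᴴ, e2, ← aeval_eq_contract]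

end WalkBlocks

/-! ### Combining the even and the odd part -/

section Combination

variable {m n : ℕ}

theorem sum_qubits_two {M : Type*} [AddCommMonoid M] (f : Qubits 2 → M) :
    ∑ e, f e = f ![0, 0] + f ![0, 1] + f ![1, 0] + f ![1, 1] := by
  rw [← (finTwoArrowEquiv (Fin 2)).symm.sum_comp, Fintype.sum_prod_type]
  simp [Fin.sum_univ_two, add_assoc]

/-- Two polynomials with `|a|² + |b|² < 1` on the unit circle can be completed by a third one to a
vector of unit norm. -/
theorem exists_complement {D : ℕ} {a b : ℂ[X]} (ha : a.natDegree ≤ D) (hb : b.natDegree ≤ D)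
    (h : ∀ z : ℂ, ‖z‖ = 1 → ‖a.eval z‖ ^ 2 + ‖b.eval z‖ ^ 2 < 1) :
    ∃ B : ℂ[X], B.natDegree ≤ D ∧ ∀ z : ℂ, ‖z‖ = 1 →
      ‖a.eval z‖ ^ 2 + ‖b.eval z‖ ^ 2 + ‖B.eval z‖ ^ 2 = 1 := by
  set G := X ^ D - a * reflect D (a.map (starRingEnd ℂ)) - b * reflect D (b.map (starRingEnd ℂ))
    with hG
  have hrefl : ∀ c : ℂ[X], c.natDegree ≤ D →
      (c * reflect D (c.map (starRingEnd ℂ))).natDegree ≤ 2 * D := fun c hc => by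
    have h1 : (reflect D (c.map (starRingEnd ℂ))).natDegree ≤ D :=
      natDegree_reflect_le.trans (max_le le_rfl (natDegree_map_le.trans hc))
    exact natDegree_mul_le.trans (by omega)
  have hdeg : G.natDegree ≤ 2 * D := by
    refine (natDegree_sub_le_of_le (natDegree_sub_le_of_le
      ((natDegree_X_pow_le D).trans (by omega : D ≤ 2 * D)) (hrefl a ha)) (hrefl b hb)).trans ?_
    simp
  have hev : ∀ z : ℂ, ‖z‖ = 1 →
      G.eval z = z ^ D * ((1 - ‖a.eval z‖ ^ 2 - ‖b.eval z‖ ^ 2 : ℝ) : ℂ) := by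
    intro z hz
    rw [hG, eval_sub, eval_sub, eval_mul, eval_mul, eval_pow, eval_X,
      eval_reflect_map_conj_of_norm_eq_one hz ha, eval_reflect_map_conj_of_norm_eq_one hz hb,
      ← Complex.normSq_eq_norm_sq, ← Complex.normSq_eq_norm_sq]
    push_cast
    rw [← Complex.mul_conj, ← Complex.mul_conj]
    ring
  obtain ⟨B, hB, hBe⟩ := exists_fejer_riesz D G hdeg fun z hz =>
    ⟨_, by linarith [h z hz], hev z hz⟩
  refine ⟨B, hB, fun z hz => ?_⟩
  have hz0 : z ≠ 0 := by rintro rfl; simp at hz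
  have h1 := mul_left_cancel₀ (pow_ne_zero D hz0) ((hev z hz).symm.trans (hBe z hz))
  have h2 := Complex.ofReal_injective h1
  linarith

theorem qubitProj_mul_self {k : ℕ} (c : Fin k) : qubitProj c * qubitProj c = qubitProj c := by
  rw [qubitProj, Matrix.diagonal_mul_diagonal]
  congr 1
  funext e
  split_ifs <;> simp

theorem conjTranspose_qubitProj {k : ℕ} (c : Fin k) : (qubitProj c)ᴴ = qubitProj c := by
  rw [qubitProj, Matrix.diagonal_conjTranspose]
  congr 1
  funext e
  simp only [Pi.star_apply]
  split_ifs <;> simp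

theorem controlled_mul_stack {σ ν : Type*} [Fintype σ] [DecidableEq σ] {k : ℕ} (c : Fin k)
    (A : Matrix σ σ ℂ) (v : Qubits k → Matrix σ ν ℂ) :
    (A ⊗ₖ qubitProj c + 1 ⊗ₖ (1 - qubitProj c)) * stack v =
      stack fun e => if e c = 1 then A * v e else v e := by
  rw [Matrix.add_mul, kronecker_mul_stack, kronecker_mul_stack, stack_add]
  congr 1
  funext e
  simp only [Pi.add_apply, qubitProj, Matrix.sub_apply, Matrix.diagonal_apply, Matrix.one_apply,
    ite_smul, sub_smul, zero_smul, one_smul, Finset.sum_ite_eq, Finset.sum_sub_distrib,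
    Finset.mem_univ, if_true, Matrix.one_mul]
  split_ifs <;> simp

/-- The correction that brings the second component to the parity of the first one. -/
noncomputable def parityShift {σ ν : Type*} [Fintype σ] [Fintype ν] [DecidableEq σ]
    (J : Matrix σ ν ℂ) (U : Matrix σ σ ℂ) (D : ℕ) : Matrix σ σ ℂ :=
  if Even D then reflectionMatrix J * U else (reflectionMatrix J * U)ᴴ

theorem implementable_parityShift (D : ℕ) :
    Implementable 1 (fun U => parityShift (ancilla m n) U D ⊗ₖ qubitProj (0 : Fin 2) +
      1 ⊗ₖ (1 - qubitProj (0 : Fin 2)) : OracleOperator m 2 n) := by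
  have hQ := qubitProj_mul_self (0 : Fin 2)
  have hQs := conjTranspose_qubitProj (0 : Fin 2)
  have hZ := reflectionMatrix_mem_unitaryGroup (conjTranspose_ancilla_mul_self (m := m) (n := n))
  have h1 := (implementable_fixed (kronecker_add_kronecker_mem_unitaryGroup hQ hQs hZ
    (one_mem _))).mul (implementable_ctrlCall (0 : Fin 2))
  have h2 : Implementable 1 (fun U => (reflectionMatrix (ancilla m n) * U) ⊗ₖ
      qubitProj (0 : Fin 2) + 1 ⊗ₖ (1 - qubitProj (0 : Fin 2)) : OracleOperator m 2 n) :=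
    h1.congr fun U _ => by rw [kronecker_add_kronecker_mul hQ, one_mul]
  by_cases hD : Even D
  · exact h2.congr fun U _ => by rw [parityShift, if_pos hD]
  · refine h2.star.congr fun U _ => ?_
    rw [parityShift, if_neg hD, Matrix.star_eq_conjTranspose, Matrix.conjTranspose_add,
      Matrix.conjTranspose_kronecker, Matrix.conjTranspose_kronecker, Matrix.conjTranspose_sub,
      Matrix.conjTranspose_one, Matrix.conjTranspose_one, hQs]

/-- The isometry that adds `m` oracle ancillas and two extra qubits in state zero. -/
noncomputable def fullAncilla (m n : ℕ) :
    Matrix ((Qubits m × Qubits n) × Qubits 2) (Qubits n) ℂ :=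
  stack (Pi.single (0 : Qubits 2) (ancilla m n))

/-- The first extra qubit selects `a` or `b`, the second flags the completion. A controlled parity
shift on the `b` branch and projection onto the uniform superposition of the first qubit add the
branches, at the price of `1/√2`. -/
theorem exists_implementable_combination {D : ℕ} {a b : ℂ[X]} (ha : a.natDegree ≤ D)
    (hb : b.natDegree ≤ D) (h : ∀ z : ℂ, ‖z‖ = 1 → ‖a.eval z‖ ^ 2 + ‖b.eval z‖ ^ 2 < 1) :
    ∃ F : OracleOperator m 2 n, Implementable (D + 1) F ∧
      ∀ U ∈ Matrix.unitaryGroup (Qubits m × Qubits n) ℂ,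
        (fullAncilla m n)ᴴ * F U * fullAncilla m n = ((√2 : ℝ) : ℂ)⁻¹ • ((ancilla m n)ᴴ *
          (bwdProd (ancilla m n) U D * aeval (walk (ancilla m n) U) a +
            parityShift (ancilla m n) U D *
              (bwdProd (ancilla m n) U D * aeval (walk (ancilla m n) U) b)) * ancilla m n) := by
  obtain ⟨B, hB, hBe⟩ := exists_complement ha hb h
  -- Three slots hold `a`, `b` and the completion `B`; the fourth is the zero component that layer
  -- stripping requires.
  set p : Qubits 2 → ℂ[X] := fun e =>
    if e 0 = 0 then (if e 1 = 0 then a else B) else (if e 1 = 0 then b else 0) with hp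
  have hi₀ : p ![1, 1] = 0 := by simp [hp]
  have hdeg : ∀ e, (p e).natDegree ≤ D := by
    intro e
    simp only [hp]
    split_ifs
    exacts [ha, hB, hb, by simp]
  have hnorm : ∀ z : ℂ, ‖z‖ = 1 →
      ∑ e, (p e).eval z * (starRingEnd ℂ) ((p e).eval z) = 1 := by
    intro z hz
    rw [sum_qubits_two]
    simp only [Complex.mul_conj, Complex.normSq_eq_norm_sq]
    have := hBe z hz
    simp only [hp, Matrix.cons_val_zero, Matrix.cons_val_one, if_true, one_ne_zero, if_false,
      eval_zero, norm_zero]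
    rw [← Complex.ofReal_add, ← Complex.ofReal_add, ← Complex.ofReal_add, ← Complex.ofReal_one]
    congr 1
    linarith
  obtain ⟨F, hF, hFe⟩ := exists_implementable_stack (m := m) (n := n) (k := 2) (i₀ := ![1, 1]) D p hi₀ hdeg
    hnorm
  have hs : ((√2 : ℝ) : ℂ)⁻¹ * ((√2 : ℝ) : ℂ)⁻¹ = 1 / 2 := by
    rw [← mul_inv, ← Complex.ofReal_mul, Real.mul_self_sqrt zero_le_two]
    norm_num
  obtain ⟨R, hR, hRc⟩ := exists_unitary_col_eq (0 : Qubits 2)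
    (c := fun e => if e 1 = 0 then ((√2 : ℝ) : ℂ)⁻¹ else 0) (by
      rw [sum_qubits_two]
      simp only [Matrix.cons_val_one, Matrix.cons_val_fin_one, if_true, one_ne_zero, if_false,
        map_inv₀, Complex.conj_ofReal, hs]
      norm_num)
  have hR0 : ∀ e, (star R) 0 e = if e 1 = 0 then ((√2 : ℝ) : ℂ)⁻¹ else 0 := by
    intro e
    rw [Matrix.star_apply, hRc]
    split_ifs
    · rw [← starRingEnd_apply, map_inv₀, Complex.conj_ofReal]
    · simp
  have h3 := implementable_fixed (m := m) (n := n)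
    (one_kronecker_mem_unitaryGroup (σ := Qubits m × Qubits n) (Unitary.star_mem hR))
  have h4 := (h3.mul (implementable_parityShift D)).mul hF
  rw [show 0 + 1 + D = D + 1 by omega] at h4
  refine ⟨_, h4, fun U hU => ?_⟩
  simp only [fullAncilla]
  rw [Matrix.mul_assoc, Matrix.mul_assoc, hFe U hU, Matrix.mul_assoc, controlled_mul_stack,
    kronecker_mul_stack, conjTranspose_stack_single_mul_stack, sum_qubits_two]
  simp only [hR0, hp, Matrix.cons_val_zero, Matrix.cons_val_one, Matrix.cons_val_fin_one, if_true,
    one_ne_zero, zero_ne_one, if_false, zero_smul, add_zero, Matrix.one_mul]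
  rw [← smul_add, Matrix.mul_smul, ← Matrix.mul_assoc (parityShift _ _ _), ← Matrix.add_mul,
    ← Matrix.mul_assoc]

section Cancellation

variable {A : Type*} [Ring A] [Algebra ℂ A] {w w' : A} {N : ℕ} {r : ℂ[X]}

theorem pow_mul_pow_of_inverse {A : Type*} [Ring A] {w w' : A} (h : w * w' = 1) (h' : w' * w = 1) (N : ℕ) : w' ^ N * w ^ N = 1 := by
  have hc : Commute w' w := h'.trans h.symm
  rw [← hc.mul_pow, h', one_pow]

theorem pow_mul_aeval_X_mul_homogenizeCosSq (h : w * w' = 1) (h' : w' * w = 1)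
    (hr : r.degree < N) :
    w' ^ N * aeval w (X * homogenizeCosSq N r) = aeval (cosSq w w') r := by
  rw [map_mul, aeval_X, mul_aeval_homogenizeCosSq h h' hr, ← mul_assoc,
    pow_mul_pow_of_inverse h h', one_mul]

theorem pow_mul_aeval_homogenizeCosSq (h : w * w' = 1) (h' : w' * w = 1)
    (hr : r.degree < (N + 1 : ℕ)) :
    w' ^ N * aeval w (homogenizeCosSq (N + 1) r) = aeval (cosSq w w') r := by
  rw [← pow_mul_aeval_X_mul_homogenizeCosSq h h' hr, map_mul, aeval_X, pow_succ, ← mul_assoc,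
    mul_assoc _ w', h', mul_one]

theorem pow_mul_aeval_half_mul_homogenizeCosSq (h : w * w' = 1) (h' : w' * w = 1)
    (hr : r.degree < N) :
    w' ^ N * aeval w (C (1 / 2) * (1 + X) * homogenizeCosSq N r) =
      ((1 / 2 : ℂ) • (1 + w')) * aeval (cosSq w w') r := by
  have h1 : 1 + w = (1 + w') * w := by rw [add_mul, one_mul, h', add_comm]
  have h2 : Commute (w' ^ N) (1 + w') :=
    (Commute.one_right _).add_right ((Commute.refl w').pow_left N)
  rw [map_mul, map_mul, aeval_C, map_add, map_one, aeval_X, ← Algebra.smul_def, h1, smul_mul_assoc,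
    smul_mul_assoc, mul_smul_comm, mul_assoc (1 + w'),
    mul_aeval_homogenizeCosSq h h' hr, ← mul_assoc, h2.eq, mul_assoc, ← mul_assoc (w' ^ N),
    pow_mul_pow_of_inverse h h', one_mul]

end Cancellation

theorem natDegree_half_mul_le (q : ℂ[X]) :
    (C (1 / 2) * (1 + X) * q).natDegree ≤ 1 + q.natDegree := by
  have h1 : (1 + X : ℂ[X]).natDegree ≤ 1 := by
    rw [add_comm, ← C_1]; exact (natDegree_X_add_C _).le
  exact natDegree_mul_le.trans (Nat.add_le_add_right ((natDegree_C_mul_le _ _).trans h1) _)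

theorem norm_pair_lt {p : ℂ[X]} (hb : ∀ x : ℝ, |x| ≤ 1 → ‖p.eval (x : ℂ)‖ ^ 2 < 2) {N M : ℕ}
    (h1 : (contract 2 p).degree < N) (h2 : (contract 2 p.divX).degree < M) {z : ℂ}
    (hz : ‖z‖ = 1) :
    ‖((√2 : ℝ) : ℂ)⁻¹ * (homogenizeCosSq N (contract 2 p)).eval z‖ ^ 2 +
      ‖((√2 : ℝ) : ℂ)⁻¹ *
        (C (1 / 2) * (1 + X) * homogenizeCosSq M (contract 2 p.divX)).eval z‖ ^ 2 < 1 := by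
  have hre := abs_le.1 ((Complex.abs_re_le_norm z).trans hz.le)
  have h := contract_parallelogram hb (s := (1 + z.re) / 2) (by linarith [hre.1])
    (by linarith [hre.2])
  have hs : ‖((√2 : ℝ) : ℂ)⁻¹‖ ^ 2 = 1 / 2 := by
    rw [norm_inv, Complex.norm_real, Real.norm_eq_abs, inv_pow, sq_abs, Real.sq_sqrt zero_le_two]
    norm_num
  have e : (C (1 / 2) * (1 + X) * homogenizeCosSq M (contract 2 p.divX)).eval z =
      (1 + z) / 2 * (homogenizeCosSq M (contract 2 p.divX)).eval z := by
    simp only [eval_mul, eval_C, eval_add, eval_one, eval_X]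
    ring
  rw [e, norm_mul, norm_mul, norm_mul, mul_pow, mul_pow, mul_pow, hs, norm_half_one_add_sq hz,
    norm_eval_homogenizeCosSq hz h1, norm_eval_homogenizeCosSq hz h2]
  linarith

/-- A polynomial of degree at most `D` that is bounded by `√2` on `[-1, 1]` is implemented, with a
factor `1 / 2`, by a circuit with `D + 1` calls. -/
theorem exists_implementable_half {D : ℕ} {p : ℂ[X]} (hp : p.degree < (D + 1 : ℕ))
    (hb : ∀ x : ℝ, |x| ≤ 1 → ‖p.eval (x : ℂ)‖ ^ 2 < 2) :
    ∃ F : OracleOperator m 2 n, Implementable (D + 1) F ∧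
      ∀ U ∈ Matrix.unitaryGroup (Qubits m × Qubits n) ℂ,
        ((ancilla m n)ᴴ * U * ancilla m n).IsHermitian →
        (fullAncilla m n)ᴴ * F U * fullAncilla m n =
          (1 / 2 : ℂ) • aeval ((ancilla m n)ᴴ * U * ancilla m n) p := by
  have hJ := conjTranspose_ancilla_mul_self (m := m) (n := n)
  have hs : ((√2 : ℝ) : ℂ)⁻¹ * ((√2 : ℝ) : ℂ)⁻¹ = 1 / 2 := by
    rw [← mul_inv, ← Complex.ofReal_mul, Real.mul_self_sqrt zero_le_two]
    norm_num
  rcases Nat.even_or_odd' D with ⟨k, rfl | rfl⟩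
  · have h1 := degree_contract_two_lt (N := k + 1) hp (by omega)
    have h2 := degree_contract_two_divX_lt (N := k) hp (by omega)
    have d1 := natDegree_homogenizeCosSq_le (k + 1) (contract 2 p)
    have d2 := natDegree_homogenizeCosSq_le k (contract 2 p.divX)
    have d3 : (C (1 / 2) * (1 + X) * homogenizeCosSq k (contract 2 p.divX)).natDegree ≤ 2 * k := by
      -- For `k = 0` the subtraction in the degree bound truncates, but the sum defining
      -- `homogenizeCosSq 0` is empty.
      rcases k with _ | k
      · simp [homogenizeCosSq]
      · exact (natDegree_half_mul_le _).trans (by omega)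
    obtain ⟨F, hF, hFe⟩ := exists_implementable_combination (m := m) (n := n) (D := 2 * k)
      (a := C ((√2 : ℝ) : ℂ)⁻¹ * homogenizeCosSq (k + 1) (contract 2 p))
      (b := C ((√2 : ℝ) : ℂ)⁻¹ *
        (C (1 / 2) * (1 + X) * homogenizeCosSq k (contract 2 p.divX)))
      ((natDegree_C_mul_le _ _).trans (by omega)) ((natDegree_C_mul_le _ _).trans d3) (by
        intro z hz
        rw [eval_C_mul, eval_C_mul]
        exact norm_pair_lt hb h1 h2 hz)
    refine ⟨F, hF, fun U hU hH => ?_⟩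
    have hw := walk_mul_conjTranspose_walk hJ hU
    have hw' := conjTranspose_walk_mul_walk hJ hU
    rw [hFe U hU, bwdProd, parityShift, if_pos (even_two_mul k), if_pos (even_two_mul k),
      Nat.mul_div_cancel_left k two_pos, ← smul_eq_C_mul ((√2 : ℝ) : ℂ)⁻¹,
      ← smul_eq_C_mul ((√2 : ℝ) : ℂ)⁻¹, map_smul, map_smul,
      mul_smul_comm, mul_smul_comm, pow_mul_aeval_homogenizeCosSq hw hw' h1,
      pow_mul_aeval_half_mul_homogenizeCosSq hw hw' h2, mul_smul_comm, ← smul_add, ← mul_assoc,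
      Matrix.mul_smul, Matrix.smul_mul, block_even_add_odd hJ hU hH, smul_smul, hs]
  · have h1 := degree_contract_two_lt (N := k + 1) hp (by omega)
    have h2 := degree_contract_two_divX_lt (N := k + 1) hp (by omega)
    have d1 := natDegree_homogenizeCosSq_le (k + 1) (contract 2 p)
    have d2 := natDegree_homogenizeCosSq_le (k + 1) (contract 2 p.divX)
    have d3 := natDegree_half_mul_le (homogenizeCosSq (k + 1) (contract 2 p.divX))
    have d4 : (X * homogenizeCosSq (k + 1) (contract 2 p)).natDegree ≤ 2 * k + 1 :=
      natDegree_mul_le.trans (by rw [natDegree_X]; omega)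
    -- For odd `D` the alternating product carries an extra `Z U`, so the odd part is the one in
    -- place, and the even part goes to the shifted slot, where `(Z U)†` undoes that factor.
    obtain ⟨F, hF, hFe⟩ := exists_implementable_combination (m := m) (n := n) (D := 2 * k + 1)
      (a := C ((√2 : ℝ) : ℂ)⁻¹ *
        (C (1 / 2) * (1 + X) * homogenizeCosSq (k + 1) (contract 2 p.divX)))
      (b := C ((√2 : ℝ) : ℂ)⁻¹ * (X * homogenizeCosSq (k + 1) (contract 2 p)))
      ((natDegree_C_mul_le _ _).trans (by omega)) ((natDegree_C_mul_le _ _).trans d4) (by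
        intro z hz
        have := norm_pair_lt hb h1 h2 hz
        have e : (X * homogenizeCosSq (k + 1) (contract 2 p)).eval z =
            z * (homogenizeCosSq (k + 1) (contract 2 p)).eval z := by rw [eval_mul, eval_X]
        rw [eval_C_mul, eval_C_mul, e, norm_mul _ (z * _), norm_mul z, hz, one_mul, ← norm_mul,
          add_comm]
        exact this)
    refine ⟨F, hF, fun U hU hH => ?_⟩
    have hw := walk_mul_conjTranspose_walk hJ hU
    have hw' := conjTranspose_walk_mul_walk hJ hU
    have hodd : ¬ Even (2 * k + 1) := by grind
    have hZU : (reflectionMatrix (ancilla m n) * U)ᴴ * (reflectionMatrix (ancilla m n) * U) = 1 :=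
      Matrix.mem_unitaryGroup_iff'.1 (mul_mem (reflectionMatrix_mem_unitaryGroup hJ) hU)
    have hb : bwdProd (ancilla m n) U (2 * k + 1) =
        reflectionMatrix (ancilla m n) * U * (walk (ancilla m n) U)ᴴ ^ (k + 1) := by
      rw [bwdProd, if_neg hodd, show (2 * k + 1) / 2 = k by omega,
        ← reflection_mul_oracle_mul_conjTranspose_walk hJ hU, pow_succ', mul_assoc _ _ (_ ^ k)]
    rw [hFe U hU, hb, parityShift, if_neg hodd, ← smul_eq_C_mul ((√2 : ℝ) : ℂ)⁻¹,
      ← smul_eq_C_mul ((√2 : ℝ) : ℂ)⁻¹, map_smul, map_smul, mul_smul_comm, mul_smul_comm, mul_assoc _ (_ ^ (k + 1)), mul_assoc _ (_ ^ (k + 1)),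
      pow_mul_aeval_X_mul_homogenizeCosSq hw hw' h1,
      pow_mul_aeval_half_mul_homogenizeCosSq hw hw' h2, mul_smul_comm,
      ← mul_assoc (reflectionMatrix _ * U)ᴴ, hZU, one_mul, ← smul_add, ← mul_assoc, add_comm,
      Matrix.mul_smul, Matrix.smul_mul, block_even_add_odd hJ hU hH, smul_smul, hs]

end Combination

/-! ### Numerical bounds and error propagation -/

section Estimates

theorem exp_one_div_thirteen_bounds :
    1.0799588 < Real.exp (1 / 13) ∧ Real.exp (1 / 13) < 1.0799590001 := by
  constructor
  · have := Real.sum_le_exp_of_nonneg (x := 1 / 13) (by norm_num) 7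
    refine lt_of_lt_of_le ?_ this
    norm_num [Finset.sum_range_succ, Nat.factorial]
  · have := Real.exp_bound' (x := 1 / 13) (by norm_num) (by norm_num) (n := 7) (by norm_num)
    refine this.trans_lt ?_
    norm_num [Finset.sum_range_succ, Nat.factorial]

theorem abs_hamSimConst_sub_lt : |hamSimConst - 1.47762| < 0.000005 := by
  obtain ⟨he1, he2⟩ := exp_one_div_thirteen_bounds
  have hs1 : √(2 * Real.pi) < 2.5066283 := by
    rw [Real.sqrt_lt' (by norm_num)]
    linarith [Real.pi_lt_d20, show (2 : ℝ) * 3.1415926535897932385 < 2.5066283 ^ 2 by norm_num]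
  have hs2 : 2.5066282 < √(2 * Real.pi) := by
    refine Real.lt_sqrt_of_sq_lt ?_
    linarith [Real.pi_gt_d20, show (2.5066282 : ℝ) ^ 2 < 2 * 3.1415926535897932384 by norm_num]
  have h1 : √(2 * Real.pi) * Real.exp (1 / 13) < 2.5066283 * 1.0799590001 :=
    mul_lt_mul'' hs1 he2 (Real.sqrt_nonneg _) (Real.exp_pos _).le
  have h2 : 2.5066282 * 1.0799588 < √(2 * Real.pi) * Real.exp (1 / 13) :=
    mul_lt_mul'' hs2 he1 (by norm_num) (by norm_num)
  have hpos : 0 < √(2 * Real.pi) * Real.exp (1 / 13) := lt_trans (by norm_num) h2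
  rw [hamSimConst, abs_lt, lt_sub_iff_add_lt, sub_lt_iff_lt_add, lt_div_iff₀ hpos,
    div_lt_iff₀ hpos]
  constructor
  · linarith
  · linarith

theorem div_pow_le_exp_sub {x : ℝ} (hx : 0 ≤ x) {q : ℕ} (hq : 0 < q) :
    (x / q) ^ q ≤ Real.exp (x - q) := by
  have hq' : (0 : ℝ) < q := Nat.cast_pos.2 hq
  have h1 : x / q ≤ Real.exp (x / q - 1) := by
    have := Real.add_one_le_exp (x / q - 1)
    linarith
  calc (x / q) ^ q ≤ Real.exp (x / q - 1) ^ q := pow_le_pow_left₀ (by positivity) h1 q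
    _ = Real.exp (x - q) := by
      rw [← Real.exp_nat_mul]
      congr 1
      field_simp

/-- The interpolation error for the number of queries in the theorem. -/
theorem approximation_error_le {t δ : ℝ} (hδ : 0 < δ) {q : ℕ} (hq : 0 < q)
    (h : Real.exp 1 / 2 * |t| + Real.log (2 * hamSimConst / δ) ≤ q) :
    2 * (|t| / 2) ^ q / q.factorial ≤ 0.275 * δ := by
  have hc : 0 < hamSimConst := by
    have := abs_lt.1 abs_hamSimConst_sub_lt
    linarith
  have hq' : (1 : ℝ) ≤ q := Nat.one_le_cast.2 hq
  set s := √(2 * Real.pi) with hs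
  have hspos : 0 < s := Real.sqrt_pos.2 (by positivity)
  have hst := Stirling.le_factorial_stirling q
  -- The factor `√q ≥ 1` in Stirling's lower bound is dropped.
  have hsq : s ≤ √(2 * Real.pi * q) := Real.sqrt_le_sqrt (by nlinarith [Real.pi_pos])
  have h1 : s * (q / Real.exp 1) ^ q ≤ q.factorial :=
    (mul_le_mul_of_nonneg_right hsq (by positivity)).trans hst
  have h2 := div_pow_le_exp_sub (x := Real.exp 1 / 2 * |t|) (by positivity) hq
  have h3 : Real.exp (Real.exp 1 / 2 * |t| - q) ≤ δ / (2 * hamSimConst) := by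
    rw [← Real.exp_log (show 0 < δ / (2 * hamSimConst) by positivity)]
    refine Real.exp_le_exp.2 ?_
    rw [← inv_div (2 * hamSimConst) δ, Real.log_inv]
    linarith
  have h4 : (|t| / 2) ^ q = (Real.exp 1 / 2 * |t| / q) ^ q * (q / Real.exp 1) ^ q := by
    rw [← mul_pow]
    congr 1
    have := Real.exp_pos 1
    field_simp
  have h5 : s * hamSimConst * Real.exp (1 / 13) = 4 := by
    rw [hamSimConst, ← hs]
    have := Real.exp_pos (1 / 13)
    field_simp
  rw [div_le_iff₀ (by positivity), h4]
  have h6 : (Real.exp 1 / 2 * |t| / q) ^ q ≤ δ / (2 * hamSimConst) := h2.trans h3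
  have h7 : δ / (2 * hamSimConst) = s * δ * Real.exp (1 / 13) / 8 := by
    rw [div_eq_div_iff (by positivity) (by norm_num)]
    linear_combination (-2 * δ) * h5
  -- By the definition of `c`, the error is at most `δ / (c √(2π)) = δ e^{1/13} / 4`, and `e^{1/13}
  -- / 4` is about `0.27`.
  have h8 : Real.exp (1 / 13) / 8 * 2 ≤ 0.275 := by
    have := exp_one_div_thirteen_bounds.2
    linarith
  have h9 : 0 ≤ ((q : ℝ) / Real.exp 1) ^ q := by positivity
  calc 2 * ((Real.exp 1 / 2 * |t| / q) ^ q * (q / Real.exp 1) ^ q)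
      ≤ 2 * (s * δ * Real.exp (1 / 13) / 8 * (q / Real.exp 1) ^ q) := by
        rw [← h7]
        gcongr
    _ = (Real.exp (1 / 13) / 8 * 2) * δ * (s * (q / Real.exp 1) ^ q) := by ring
    _ ≤ 0.275 * δ * q.factorial := by gcongr

/-- Functional calculus: the spectrum of a Hermitian contraction lies in `[-1, 1]`, so the scalar
bound transfers. -/
theorem norm_exp_sub_aeval_le {ν : Type*} [Fintype ν] [DecidableEq ν] {K : Matrix ν ν ℂ}
    (hK : K.IsHermitian) (hK1 : ‖K‖ ≤ 1) {c : ℂ} {p : ℂ[X]} {ε : ℝ} (hε : 0 ≤ ε)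
    (h : ∀ x : ℝ, |x| ≤ 1 → ‖Complex.exp (c * x) - p.eval (x : ℂ)‖ ≤ ε) :
    ‖NormedSpace.exp (c • K) - aeval K p‖ ≤ ε := by
  have hsa : IsSelfAdjoint K := hK
  have hn : IsStarNormal K := hsa.isStarNormal
  have h1 : NormedSpace.exp (c • K) = cfc (fun z => Complex.exp (c * z)) K := by
    rw [cfc_comp_const_mul c Complex.exp K, CFC.complex_exp_eq_normedSpace_exp]
  rw [h1, ← cfc_polynomial p K, ← cfc_sub (fun z => Complex.exp (c * z)) p.eval K]
  refine norm_cfc_le hε fun z hz => ?_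
  have hzr := hsa.mem_spectrum_eq_re hz
  have hz1 : ‖z‖ ≤ 1 := by
    rcases isEmpty_or_nonempty ν with hν | hν
    · have : Subsingleton (Matrix ν ν ℂ) := inferInstance
      simp [spectrum.of_subsingleton] at hz
    · exact (spectrum.norm_le_norm_of_mem hz).trans hK1
  have := h z.re ((Complex.abs_re_le_norm z).trans hz1)
  rwa [← hzr] at this

/-- With `A = E - Δ`, the zeroth-order terms cancel because `E E† E = E`, and the linear term is `(Δ
- E Δ† E) / 2`, of norm at most `ε`. The rest is quadratic and cubic. -/
theorem norm_amplified_sub_le {ν : Type*} [Fintype ν] [DecidableEq ν] {A E : Matrix ν ν ℂ}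
    (hE : E ∈ Matrix.unitaryGroup ν ℂ) (hE1 : ‖E‖ ≤ 1) {ε : ℝ} (h : ‖E - A‖ ≤ ε) :
    ‖E - ((3 / 2 : ℂ) • A - (1 / 2 : ℂ) • (A * Aᴴ * A))‖ ≤ ε + (3 * ε ^ 2 + ε ^ 3) / 2 := by
  obtain ⟨Δ, rfl⟩ : ∃ Δ, A = E - Δ := ⟨E - A, by abel⟩
  rw [sub_sub_cancel] at h
  have h1 : E * Eᴴ = 1 := Matrix.mem_unitaryGroup_iff.1 hE
  have h1' : Eᴴ * E = 1 := Matrix.mem_unitaryGroup_iff'.1 hE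
  have hε : 0 ≤ ε := (norm_nonneg _).trans h
  have hE2 : ‖Eᴴ‖ ≤ 1 := (Matrix.l2_opNorm_conjTranspose E).trans_le hE1
  have hΔ2 : ‖Δᴴ‖ ≤ ε := (Matrix.l2_opNorm_conjTranspose Δ).trans_le h
  have e : E - ((3 / 2 : ℂ) • (E - Δ) - (1 / 2 : ℂ) • ((E - Δ) * (E - Δ)ᴴ * (E - Δ))) =
      (1 / 2 : ℂ) • (Δ - E * Δᴴ * E + E * Δᴴ * Δ + Δ * Eᴴ * Δ + Δ * Δᴴ * E - Δ * Δᴴ * Δ) := by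
    have a1 : (E - Δ) * (E - Δ)ᴴ * (E - Δ) = E - Δ - Δ - E * Δᴴ * E + E * Δᴴ * Δ + Δ * Eᴴ * Δ +
        Δ * Δᴴ * E - Δ * Δᴴ * Δ := by
      rw [Matrix.conjTranspose_sub]
      simp only [mul_sub, sub_mul, h1, one_mul, mul_assoc, h1', mul_one]
      abel
    rw [a1]
    module
  have key : ∀ X Y Z : Matrix ν ν ℂ, ∀ x y z : ℝ, 0 ≤ x → 0 ≤ y → ‖X‖ ≤ x → ‖Y‖ ≤ y → ‖Z‖ ≤ z →
      ‖X * Y * Z‖ ≤ x * y * z := fun X Y Z x y z hx hy hX hY hZ =>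
    (norm_mul_le _ _).trans (mul_le_mul ((norm_mul_le _ _).trans
      (mul_le_mul hX hY (norm_nonneg _) hx)) hZ (norm_nonneg _) (mul_nonneg hx hy))
  have k1 := key E Δᴴ E 1 ε 1 zero_le_one hε hE1 hΔ2 hE1
  have k2 := key E Δᴴ Δ 1 ε ε zero_le_one hε hE1 hΔ2 h
  have k3 := key Δ Eᴴ Δ ε 1 ε hε zero_le_one h hE2 h
  have k4 := key Δ Δᴴ E ε ε 1 hε hε h hΔ2 hE1
  have k5 := key Δ Δᴴ Δ ε ε ε hε hε h hΔ2 h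
  rw [e, norm_smul]
  have hn : ‖Δ - E * Δᴴ * E + E * Δᴴ * Δ + Δ * Eᴴ * Δ + Δ * Δᴴ * E - Δ * Δᴴ * Δ‖ ≤
      ε + 1 * ε * 1 + 1 * ε * ε + ε * 1 * ε + ε * ε * 1 + ε * ε * ε :=
    norm_sub_le_of_le (norm_add_le_of_le (norm_add_le_of_le (norm_add_le_of_le
      (norm_sub_le_of_le h k1) k2) k3) k4) k5
  have h2 : ‖(1 / 2 : ℂ)‖ = 1 / 2 := by norm_num
  rw [h2]
  linarith

end Estimates

/-! ### Assembly -/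

section Main

variable {m n : ℕ}

theorem fullAncilla_eq : fullAncilla m n = embMatrix fun i => ((0, i), 0) :=
  (embMatrix_eq_stack _ _).symm

theorem conjTranspose_fullAncilla_mul_self : (fullAncilla m n)ᴴ * fullAncilla m n = 1 := by
  rw [fullAncilla_eq]
  exact conjTranspose_embMatrix_mul_self fun _ _ h => (Prod.mk.inj (Prod.mk.inj h).1).2

/-- Amplitude amplification triples the number of calls. -/
theorem Implementable.amplify {F : OracleOperator m 2 n} {q : ℕ} (hF : Implementable q F) :
    ∃ G : OracleOperator m 2 n, Implementable (3 * q) G ∧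
      ∀ U ∈ Matrix.unitaryGroup (Qubits m × Qubits n) ℂ, ∀ A : Matrix (Qubits n) (Qubits n) ℂ,
        (fullAncilla m n)ᴴ * F U * fullAncilla m n = (1 / 2 : ℂ) • A →
        (fullAncilla m n)ᴴ * G U * fullAncilla m n =
          (3 / 2 : ℂ) • A - (1 / 2 : ℂ) • (A * Aᴴ * A) := by
  have hJ := conjTranspose_fullAncilla_mul_self (m := m) (n := n)
  have hZ := reflectionMatrix_mem_unitaryGroup hJ
  have h1 := implementable_fixed hZ
  have h2 := implementable_fixed (M := -1) (m := m) (n := n) (k := 2) (by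
    rw [Matrix.mem_unitaryGroup_iff, star_neg, star_one, neg_mul_neg, one_mul])
  have h3 := h2.mul (hF.mul (h1.mul (hF.star.mul (h1.mul hF))))
  rw [show 0 + (q + (0 + (q + (0 + q)))) = 3 * q by omega] at h3
  refine ⟨_, h3, fun U hU A hA => ?_⟩
  rw [neg_mul, one_mul, amplitude_amplification hJ (hF.mem_unitaryGroup hU), hA,
    Matrix.conjTranspose_smul]
  simp only [Matrix.smul_mul, Matrix.mul_smul, smul_smul]
  rw [show Star.star (1 / 2 : ℂ) = 1 / 2 by simp]
  norm_num

/-- Flipping the extra qubits away from zero annihilates the block, whatever calls pad the circuit.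
This serves `δ ≥ 1`, where zero is close enough to any unitary. -/
theorem exists_implementable_zero (q : ℕ) :
    ∃ F : OracleOperator m 2 n, Implementable q F ∧
      ∀ U ∈ Matrix.unitaryGroup (Qubits m × Qubits n) ℂ,
        (fullAncilla m n)ᴴ * F U * fullAncilla m n = 0 := by
  have h1 : Implementable q fun U : Matrix (Qubits m × Qubits n) (Qubits m × Qubits n) ℂ =>
      (U ^ q) ⊗ₖ (1 : Matrix (Qubits 2) (Qubits 2) ℂ) := by
    induction q with
    | zero =>
      refine (implementable_fixed (one_mem _)).congr fun U _ => ?_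
      rw [pow_zero, Matrix.one_kronecker_one]
    | succ q ih =>
      refine (ih.mul implementable_call).congr fun U _ => ?_
      rw [← Matrix.mul_kronecker_mul, mul_one, pow_succ]
  obtain ⟨R, hR, hRc⟩ := exists_unitary_col_eq (0 : Qubits 2) (c := Pi.single ![1, 1] 1) (by
    rw [sum_qubits_two]
    simp)
  have h2 := (implementable_fixed (one_kronecker_mem_unitaryGroup
    (σ := Qubits m × Qubits n) hR)).mul h1
  rw [zero_add] at h2
  refine ⟨_, h2, fun U _ => ?_⟩
  have hR0 : R 0 0 = 0 := by
    rw [hRc, Pi.single_eq_of_ne]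
    intro h
    have := congrFun h 0
    simp at this
  rw [← Matrix.mul_kronecker_mul, mul_one, one_mul, fullAncilla_eq,
    conjTranspose_embMatrix_mul_mul]
  ext i j
  simp [hR0]

theorem Implementable.exists_isBlockEncoding {F : OracleOperator m 2 n} {q : ℕ}
    (hF : Implementable q F) :
    ∃ C : QueryCircuit m 2 n, C.calls = q ∧
      ∀ U ∈ Matrix.unitaryGroup (Qubits m × Qubits n) ℂ,
      ∀ (E : Matrix (Qubits n) (Qubits n) ℂ) (δ : ℝ),
        ‖E - (fullAncilla m n)ᴴ * F U * fullAncilla m n‖ ≤ δ →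
        IsBlockEncoding 1 (m + 2) δ E (C.eval U) := by
  obtain ⟨C, hC, h⟩ := hF
  refine ⟨C, hC, fun U hU E δ hE => ⟨one_pos, C.eval_mem_unitaryGroup hU, _, fun i j => ?_, hE⟩⟩
  rw [h U hU, fullAncilla_eq, conjTranspose_embMatrix_mul_mul, Complex.ofReal_one, div_one]
  rfl

theorem IsBlockEncoding.conjTranspose_ancilla_mul_mul {α : ℝ}
    {H : Matrix (Qubits n) (Qubits n) ℂ}
    {U : Matrix (Qubits m × Qubits n) (Qubits m × Qubits n) ℂ} (h : IsBlockEncoding α m 0 H U) :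
    (ancilla m n)ᴴ * U * ancilla m n = (α : ℂ)⁻¹ • H := by
  obtain ⟨-, -, X', hX, hn⟩ := h
  obtain rfl : H = X' := sub_eq_zero.1 (norm_eq_zero.1 (le_antisymm hn (norm_nonneg _)))
  rw [ancilla, conjTranspose_embMatrix_mul_mul]
  ext i j
  rw [Matrix.submatrix_apply, hX, Matrix.smul_apply, smul_eq_mul, div_eq_inv_mul]

theorem norm_ancilla_le : ‖ancilla m n‖ ≤ 1 := by
  have h := Matrix.l2_opNorm_conjTranspose_mul_self (ancilla m n)
  rw [conjTranspose_ancilla_mul_self, norm_one] at h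
  nlinarith [norm_nonneg (ancilla m n)]

theorem norm_block_le_one {U : Matrix (Qubits m × Qubits n) (Qubits m × Qubits n) ℂ}
    (hU : U ∈ Matrix.unitaryGroup (Qubits m × Qubits n) ℂ) :
    ‖(ancilla m n)ᴴ * U * ancilla m n‖ ≤ 1 := by
  have h1 : ‖U‖ ≤ 1 := (CStarRing.norm_of_mem_unitary hU).le
  have h2 := norm_ancilla_le (m := m) (n := n)
  have h3 : ‖(ancilla m n)ᴴ‖ ≤ 1 := (Matrix.l2_opNorm_conjTranspose _).trans_le h2
  refine (Matrix.l2_opNorm_mul _ _).trans ?_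
  refine mul_le_one₀ ((Matrix.l2_opNorm_mul _ _).trans ?_) (norm_nonneg _) h2
  exact mul_le_one₀ h3 (norm_nonneg _) h1

theorem exp_mem_unitaryGroup {H : Matrix (Qubits n) (Qubits n) ℂ} (hH : H.IsHermitian) (τ : ℝ) :
    NormedSpace.exp ((-(Complex.I * (τ : ℂ))) • H) ∈ Matrix.unitaryGroup (Qubits n) ℂ := by
  let +nondep : NormedAlgebra ℚ (Matrix (Qubits n) (Qubits n) ℂ) := .restrictScalars ℚ ℂ _
  refine NormedSpace.exp_mem_unitary_of_mem_skewAdjoint (skewAdjoint.mem_iff.2 ?_)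
  rw [star_smul, Matrix.star_eq_conjTranspose, hH.eq, ← neg_smul]
  congr 1
  simp

end Main

theorem mainTheorem2 :
    |hamSimConst - 1.47762| < 0.000005 ∧
    ∀ (n m : ℕ) (α τ δ : ℝ), 0 < α → 0 < δ →
      ∃ C : QueryCircuit m 2 n,
        C.calls = 3 * ⌈Real.exp 1 / 2 * α * |τ| + Real.log (2 * hamSimConst / δ)⌉₊ ∧
        ∀ (H : Matrix (Qubits n) (Qubits n) ℂ)
          (U : Matrix (Qubits m × Qubits n) (Qubits m × Qubits n) ℂ),
          H.IsHermitian → ‖H‖ ≤ 1 → IsBlockEncoding α m 0 H U →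
            IsBlockEncoding 1 (m + 2) δ (NormedSpace.exp ((-(Complex.I * (τ : ℂ))) • H))
              (C.eval U) := by
  refine ⟨abs_hamSimConst_sub_lt, fun n m α τ δ hα hδ => ?_⟩
  set R := ⌈Real.exp 1 / 2 * α * |τ| + Real.log (2 * hamSimConst / δ)⌉₊ with hR
  rcases le_or_gt 1 δ with hδ1 | hδ1
  · obtain ⟨F, hF, hFe⟩ := exists_implementable_zero (m := m) (n := n) (3 * R)
    obtain ⟨C, hC, hCe⟩ := hF.exists_isBlockEncoding
    refine ⟨C, hC, fun H U hH _ hU => hCe U hU.2.1 _ _ ?_⟩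
    rw [hFe U hU.2.1, sub_zero]
    exact (CStarRing.norm_of_mem_unitary (exp_mem_unitaryGroup hH τ)).le.trans hδ1
  -- For `δ < 1` the logarithm is positive, hence so is the ceiling, and interpolation has at least
  -- one node.
  · have hc := abs_lt.1 abs_hamSimConst_sub_lt
    have hlog : 0 < Real.log (2 * hamSimConst / δ) := by
      refine Real.log_pos ?_
      rw [lt_div_iff₀ hδ]
      linarith
    have hRpos : 0 < R := Nat.ceil_pos.2 (by positivity)
    obtain ⟨D, hD⟩ : ∃ D, R = D + 1 := ⟨R - 1, by omega⟩
    set t := α * τ with ht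
    have hle : Real.exp 1 / 2 * |t| + Real.log (2 * hamSimConst / δ) ≤ R := by
      rw [ht, abs_mul, abs_of_pos hα, ← mul_assoc]
      exact Nat.le_ceil _
    obtain ⟨p, hpdeg, hp⟩ := exists_polynomial_approx_exp t hRpos
    have herr := approximation_error_le hδ hRpos hle
    set ε := 2 * (|t| / 2) ^ R / R.factorial with hε
    have hε0 : 0 ≤ ε := by positivity
    -- The slack up to `√2` is ample: `|p| ≤ 1 + ε ≤ 1.275`.
    have hpb : ∀ x : ℝ, |x| ≤ 1 → ‖p.eval (x : ℂ)‖ ^ 2 < 2 := by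
      intro x hx
      have h1 : ‖Complex.exp (-(Complex.I * t) * x)‖ = 1 := by
        rw [show -(Complex.I * t) * x = ((-(t * x) : ℝ) : ℂ) * Complex.I by push_cast; ring,
          Complex.norm_exp_ofReal_mul_I]
      have h2 : ‖p.eval (x : ℂ)‖ ≤ 1 + ε := by
        have := norm_sub_norm_le (p.eval (x : ℂ)) (Complex.exp (-(Complex.I * t) * x))
        rw [norm_sub_rev, h1] at this
        linarith [hp x hx]
      nlinarith [norm_nonneg (p.eval (x : ℂ))]
    rw [hD] at hpdeg
    obtain ⟨F, hF, hFe⟩ := exists_implementable_half (m := m) (n := n) hpdeg hpb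
    rw [← hD] at hF
    obtain ⟨G, hG, hGe⟩ := hF.amplify
    obtain ⟨C, hC, hCe⟩ := hG.exists_isBlockEncoding
    refine ⟨C, hC, fun H U hH _ hU => hCe U hU.2.1 _ _ ?_⟩
    have hblock := hU.conjTranspose_ancilla_mul_mul
    have hherm : ((ancilla m n)ᴴ * U * ancilla m n).IsHermitian := by
      rw [hblock, Matrix.IsHermitian, Matrix.conjTranspose_smul, hH.eq, star_inv₀]
      congr 2
      exact Complex.conj_ofReal α
    have hα' : (α : ℂ) ≠ 0 := Complex.ofReal_ne_zero.2 hα.ne'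
    have hexp : (-(Complex.I * (τ : ℂ))) • H =
        (-(Complex.I * (t : ℂ))) • ((ancilla m n)ᴴ * U * ancilla m n) := by
      rw [hblock, smul_smul, ht]
      congr 1
      push_cast
      field_simp
    rw [hGe U hU.2.1 _ (hFe U hU.2.1 hherm)]
    have hE := exp_mem_unitaryGroup hH τ
    have happ := norm_exp_sub_aeval_le hherm (norm_block_le_one hU.2.1) hε0 hp
    rw [← hexp] at happ
    refine (norm_amplified_sub_le hE (CStarRing.norm_of_mem_unitary hE).le happ).trans ?_
    -- Amplification yields at most `ε (1 + 2 * 0.275) = 1.55 ε`, and `1.55 * 0.275 < 1`.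
    have hε1 : ε ≤ 0.275 := herr.trans (by linarith)
    have hε2 : ε ^ 2 ≤ 0.275 * ε := by nlinarith
    have hε3 : ε ^ 3 ≤ 0.275 * ε := by nlinarith
    linarith
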